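/- \textbf{Network and traffic.} Consider a wireless network with a finite set $\mathcal K$ of links and interference graph $G_I$ on $\mathcal K$. Let $\mathcal M$ be the set of maximal independent sets of $G_I$ and $R=|\mathcal M|$. Time is slotted. The traffic is driven by an irreducible Markov chain $\mathbf x(t)$ on a finite state space; the state $\mathbf x(t)$ determines the numbers $\tau_{l,d}(t)$ of packets with deadline $d\in\{1,\dots,d_{\max}\}$ arriving at link $l$ in slot $t$, with $\sum_d\tau_{l,d}(t)\le a_{\max}$, and every link has a positive packet arrival rate. If $\Psi_{l,d}(t)$ is the number of packets with remaining deadline $d$ in the buffer of link $l$ in slot $t$ (after arrivals), then $\Psi_{l,d}(t+1)=\Psi_{l,d+1}(t)-I_{l,d+1}(t)+\tau_{l,d}(t+1)$, where $\Psi_{l,d_{\max}+1}=I_{l,d_{\max}+1}=0$, and $I_{l,d}(t)\in\{0,1\}$ indicates that link $l$ transmits a packet with remaining deadline $d$ (at most one packet per link and slot, from those available); the links with $I_l(t)=\sum_d I_{l,d}(t)=1$ must form an independent set of $G_I$. The deficits evolve as $w_l(t+1)=[w_l(t)+\tilde a_l(t)-I_l(t)]^+$, where the deficit arrivals satisfy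 $0\le\tilde a_l(t)\le a_{\max}$ and are on average $p_l$ per arriving packet. The gain of a policy in slot $t$ is $\mathcal G(t)=\sum_l w_l(t)I_l(t)$, with the deficits under that policy. \textbf{Frame.} Fix a traffic state $x$ and $k\in\mathbb N$. Given that $\mathbf x=x$ in the slot before the frame, the frame $\mathcal F$ starts with the next slot and ends with the slot of the $k$-th return of $\mathbf x(t)$ to $x$. Let $w_0\ge 0$ be the vector of deficits at the start of the frame, $\|w_0\|=\sum_l w_{0,l}$, and let $\Psi_0$ be the packets left over from the slot before the frame. All policies start from the same $\Psi_0$, $w_0$ and face the same arrivals. A non-causal policy may choose its feasible decisions using any information, in particular the entire traffic of the frame, and may randomize. \textbf{AMMS.} In each slot $t$ let $W_M(t)=\sum_{l\in M,\ \Psi_l(t)\ne0}w_l(t)$ for $M\in\mathcal M$, list $\mathcal M$ as $M_1,\dots,M_R$ with $W_{M_1}(t)\ge\dots\ge W_{M_R}(t)$ (ties broken arbitrarily), and put $C_n=(n-1)\big/\sum_{i=1}^n W_{M_i}(t)^{-1}$, $p^n_i=1-C_n/W_{M_i}(t)$ for $i\le n$, and $p^n_i=0$ for $i>n$. (For $n=1$: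 $C_1=0$ and $p^1_1=1$; for $n\ge2$ only those $n$ with $W_{M_n}(t)>0$ are considered.) Let $n^\star$ be the largest such $n\le R$ with $p^n_n\ge0$. AMMS selects $M_i$ with probability $p^{n^\star}_i$, independently of the traffic and of its earlier selections given the current state, and transmits the earliest-deadline packet of each nonempty link of $M_i$. \textbf{Theorem.} Let $\rho=\frac{R}{2R-1}$. For every $\epsilon>0$ there is $W'$ such that for every $w_0\ge 0$ with $\|w_0\|\ge W'$, every $\Psi_0$ and every non-causal policy $\mu$, the frame gains of AMMS and of $\mu$ are integrable and $$\mathbb E\Big[\sum_{t\in\mathcal F}\mathcal G_{\mathrm{AMMS}}(t)\Big]\ \ge\ (\rho-\epsilon)\ \mathbb E\Big[\sum_{t\in\mathcal F}\mathcal G_{\mu}(t)\Big].$$ The threshold $W'$ does not depend on $\mu$, $\Psi_0$ or $w_0$. -/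

import Mathlib

open MeasureTheory ProbabilityTheory
open scoped BigOperators

namespace RTSched

noncomputable section

/-- The fixed data of a single-hop wireless network with link set `K` and deadline-constrained
Markovian traffic with (finite) set `X` of complete traffic states. A complete traffic state `y`
determines the arrivals `arr y`; what else it carries is the hidden information of the traffic. -/
structure Network (K X : Type*) [Fintype K] [Fintype X] [DecidableEq X] where
  /-- interference graph -/
  graph : SimpleGraph K
  /-- largest deadline -/
  dmax : ℕ
  /-- largest number of arrivals at a link in a slot -/
  amax : ℕ
  /-- `arr y l d` is the number of packets with deadline `d + 1` that arrive at link `l` in a slot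
  in which the traffic state is `y` -/
  arr : X → K → Fin dmax → ℕ
  /-- transition matrix of the traffic chain -/
  trans : Matrix X X ℝ
  arr_le : ∀ y l, ∑ d, arr y l d ≤ amax
  stochastic : trans ∈ Matrix.rowStochastic ℝ X
  irreducible : trans.IsIrreducible
  /-- no link is without traffic: each link has a positive packet arrival rate -/
  arr_pos : ∀ l, ∃ y d, 0 < arr y l d

variable {K X : Type*} [Fintype K] [Fintype X] [DecidableEq X]

namespace Network

variable (N : Network K X)

/-- Number of packets arriving at link `l` when the traffic state is `y`. -/
def numArr (y : X) (l : K) : ℕ := ∑ d, N.arr y l d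

/-- Buffer contents: `Ψ l d` packets with remaining deadline `d + 1` at link `l`. -/
abbrev Buffer : Type _ := K → Fin N.dmax → ℕ

/-- A transmission decision for one slot: link `l` transmits a packet with remaining deadline
`d + 1` if `I l = some d`, and stays silent if `I l = none`. -/
abbrev Schedule : Type _ := K → Option (Fin N.dmax)

/-- Buffer contents and deficits in a slot, after the arrivals of that slot. -/
structure State where
  buffer : N.Buffer
  deficit : K → ℝ

/-- Ageing by one slot: remaining deadlines drop by one and packets reaching `0` are lost. -/
def age (Ψ : N.Buffer) : N.Buffer :=
  fun l d => if h : (d : ℕ) + 1 < N.dmax then Ψ l ⟨d + 1, h⟩ else 0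

/-- Removal of the transmitted packets. -/
def remove (Ψ : N.Buffer) (I : N.Schedule) : N.Buffer :=
  fun l d => Ψ l d - (if I l = some d then 1 else 0)

/-- A decision is feasible for the buffer contents `Ψ` if each transmitting link transmits a packet
that it has and the transmitting links form an independent set of the interference graph. -/
def Feasible (Ψ : N.Buffer) (I : N.Schedule) : Prop :=
  (∀ l d, I l = some d → 0 < Ψ l d) ∧ N.graph.IsIndepSet {l | I l ≠ none}

/-- The state in slot `t` of a frame that consists of the slots `1, 2, …`, when the traffic states
are `x 1, x 2, …`, the deficit arrivals `a 1, a 2, …` and the decisions `I 1, I 2, …`. Here `w₀` is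
the vector of deficits at the start of the frame and `Ψ₀` are the packets that are left over in
slot `0`, the last slot before the frame, after the transmissions of that slot. -/
def stateAt (Ψ₀ : N.Buffer) (w₀ : K → ℝ) (x : ℕ → X) (a : ℕ → K → ℝ) (I : ℕ → N.Schedule) :
    ℕ → N.State
  | 0 => ⟨Ψ₀, w₀⟩
  | 1 => ⟨fun l d => N.age Ψ₀ l d + N.arr (x 1) l d, w₀⟩
  | t + 2 =>
    let S := stateAt Ψ₀ w₀ x a I (t + 1)
    ⟨fun l d => N.age (N.remove S.buffer (I (t + 1))) l d + N.arr (x (t + 2)) l d,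
      fun l => max 0 (S.deficit l + a (t + 1) l - (if I (t + 1) l = none then 0 else 1))⟩

/-- The gain of decision `I` in state `S`: the sum of the deficits of the transmitting links. -/
def gain (S : N.State) (I : N.Schedule) : ℝ :=
  ∑ l, if I l = none then 0 else S.deficit l

/-- The total gain over the frame of slots `1, …, F`. -/
def frameGain (Ψ₀ : N.Buffer) (w₀ : K → ℝ) (x : ℕ → X) (a : ℕ → K → ℝ) (I : ℕ → N.Schedule)
    (F : ℕ) : ℝ :=
  ∑ t ∈ Finset.Icc 1 F, N.gain (N.stateAt Ψ₀ w₀ x a I t) (I t)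

/-- The maximal independent sets of the interference graph. -/
abbrev MIS : Type _ := {M : Finset K // Maximal (fun s : Finset K => N.graph.IsIndepSet s) M}

/-- The number of maximal independent sets. -/
def numMIS : ℕ := Nat.card N.MIS

open Classical in
/-- Weight of a maximal independent set: the sum of the deficits of its nonempty links. -/
def weight (S : N.State) (M : N.MIS) : ℝ :=
  ∑ l ∈ M.1 with ∃ d, 0 < S.buffer l d, S.deficit l

/-- The earliest-deadline packet of a link (`none` if the link is empty). -/
def earliest (Ψ : Fin N.dmax → ℕ) : Option (Fin N.dmax) :=
  if h : (Finset.univ.filter fun d => 0 < Ψ d).Nonempty then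
    some ((Finset.univ.filter fun d => 0 < Ψ d).min' h)
  else none

open Classical in
/-- Transmission of the earliest-deadline packet of every nonempty link in `M`. -/
def edfSchedule (Ψ : N.Buffer) (M : N.MIS) : N.Schedule :=
  fun l => if l ∈ M.1 then N.earliest (Ψ l) else none

/-- A rule that lists the maximal independent sets in nonincreasing order of weight
in every state. Ties may be broken in any way. -/
def IsWeightOrder (ord : N.State → Fin N.numMIS ≃ N.MIS) : Prop :=
  ∀ S, Antitone fun i => N.weight S (ord S i)

end Network

/-- The subharmonic average `C_n = (n - 1) / ∑_{i ≤ n} 1 / W_i` of the first `n` weights;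
the list `W_1, …, W_R` is indexed by `Fin R`, starting at `0`. -/
def subharm {R : ℕ} (W : Fin R → ℝ) (n : ℕ) : ℝ :=
  ((n : ℝ) - 1) / ∑ i : Fin R, if (i : ℕ) < n then (W i)⁻¹ else 0

/-- `p^n_i = 1 - C_n / W_i` for `i ≤ n`, and `0` for `i > n`. -/
def mixProb {R : ℕ} (W : Fin R → ℝ) (n : ℕ) (i : Fin R) : ℝ :=
  if (i : ℕ) < n then 1 - subharm W n / W i else 0

open Classical in
/-- The largest `n` with `p^n_n ≥ 0`. For `n ≥ 2` the number `p^n_n` is only meaningful if the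
`n`-th weight is positive, and this is required; for `n = 1` one has `p^1_1 = 1`. -/
def nStar {R : ℕ} (W : Fin R → ℝ) : ℕ :=
  ((Finset.Icc 1 R).filter fun n =>
    n = 1 ∨ ∃ i : Fin R, (i : ℕ) + 1 = n ∧ 0 < W i ∧ 0 ≤ mixProb W n i).sup id

/-- The probability with which AMMS selects the maximal independent set `M` in state `S`. -/
def Network.ammsProb (N : Network K X) (ord : N.State → Fin N.numMIS ≃ N.MIS) (S : N.State)
    (M : N.MIS) : ℝ :=
  let W : Fin N.numMIS → ℝ := fun i => N.weight S (ord S i)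
  mixProb W (nStar W) ((ord S).symm M)

variable {Ω : Type*} [mΩ : MeasurableSpace Ω]

/-- `x 0, x 1, …` is the traffic chain of the network, started in state `x₀`. -/
structure IsTraffic (N : Network K X) (P : Measure Ω) (x₀ : X) (x : ℕ → Ω → X) : Prop where
  meas : ∀ t, Measurable[mΩ, ⊤] (x t)
  law : ∀ (n : ℕ) (y : ℕ → X), P.real {ω | ∀ s ≤ n, x s ω = y s} =
    if y 0 = x₀ then ∏ s ∈ Finset.range n, N.trans (y s) (y (s + 1)) else 0

/-- `a t ω l` is the deficit arrival at link `l` in slot `t`: bounded, and on average `p l` per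
arriving packet. Adding exactly `p l` for each packet, and tossing a coin with success
probability `p l` for each packet, are examples. -/
structure IsDeficitArrival (N : Network K X) (P : Measure Ω) (p : K → ℝ) (x : ℕ → Ω → X)
    (a : ℕ → Ω → K → ℝ) : Prop where
  meas : ∀ t, Measurable (a t)
  nonneg : ∀ t ω l, 0 ≤ a t ω l
  le : ∀ t ω l, a t ω l ≤ N.amax
  mean : ∀ t l, ∫ ω, a t ω l ∂P = p l * ∫ ω, (N.numArr (x t ω) l : ℝ) ∂P

/-- The number of the last slot of the frame of `k` cycles that starts after slot `0`: the `k`-th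
return time of the traffic chain to `x₀` (time `0` itself being the `0`-th visit). -/
def frameLength (x₀ : X) (x : ℕ → Ω → X) (k : ℕ) (ω : Ω) : ℕ :=
  Nat.nth (fun t => x t ω = x₀) k

/-- The decisions `I` of a policy that is neither assumed to be causal nor deterministic: the
decision in a slot may depend on everything, in particular on the entire traffic, past and future.
It only has to be feasible. -/
structure IsNonCausalRun (N : Network K X) (Ψ₀ : N.Buffer) (w₀ : K → ℝ) (x : ℕ → Ω → X)
    (a : ℕ → Ω → K → ℝ) (I : ℕ → Ω → N.Schedule) : Prop where
  meas : ∀ t, Measurable[mΩ, ⊤] (I t)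
  feasible : ∀ t ≥ 1, ∀ ω, N.Feasible
    (N.stateAt Ψ₀ w₀ (fun s => x s ω) (fun s => a s ω) (fun s => I s ω) t).buffer (I t ω)

/-- All traffic and deficit arrivals (past and future), and the sets `D` selected in the slots of
the frame before slot `t`. -/
abbrev ammsPast (N : Network K X) (x : ℕ → Ω → X) (a : ℕ → Ω → K → ℝ) (D : ℕ → Ω → N.MIS) (t : ℕ) :
    MeasurableSpace Ω :=
  (⨆ s, MeasurableSpace.comap (x s) ⊤) ⊔ (⨆ s, MeasurableSpace.comap (a s) inferInstance) ⊔
    (⨆ s ∈ Finset.Ico 1 t, MeasurableSpace.comap (D s) ⊤)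

/-- `I` are the decisions of AMMS: in each slot `t` a maximal independent set `D t` is selected with
the AMMS probabilities for the current state, by a random experiment that is otherwise independent
of the traffic and of the previous selections, and the earliest-deadline packets of its nonempty
links are transmitted. -/
structure IsAMMSRun (N : Network K X) (P : Measure Ω) (ord : N.State → Fin N.numMIS ≃ N.MIS)
    (Ψ₀ : N.Buffer) (w₀ : K → ℝ) (x : ℕ → Ω → X) (a : ℕ → Ω → K → ℝ)
    (D : ℕ → Ω → N.MIS) (I : ℕ → Ω → N.Schedule) : Prop where
  meas : ∀ t, Measurable[mΩ, ⊤] (D t)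
  sched : ∀ t ≥ 1, ∀ ω, I t ω = N.edfSchedule
    (N.stateAt Ψ₀ w₀ (fun s => x s ω) (fun s => a s ω) (fun s => I s ω) t).buffer (D t ω)
  law : ∀ t ≥ 1, ∀ M : N.MIS,
    P⟦{ω | D t ω = M} | ammsPast N x a D t⟧ =ᵐ[P] fun ω => N.ammsProb ord
      (N.stateAt Ψ₀ w₀ (fun s => x s ω) (fun s => a s ω) (fun s => I s ω) t) M

end

end RTSched

/-! In one slot, let `D` be the set drawn by AMMS and `M'` any set fixed before the draw. The mixing
probabilities equalise the miss loss `(1 - p_i) W_i` at `C_{n*}` over the sets that are mixed, every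
other set weighs at most `C_{n*}`, and Cauchy–Schwarz gives `R C_{n*} ≤ (R - 1) E[W_D]`. Hence
`E[W_D + 1{D ≠ M'} W_{M'}] ≤ (2R - 1)/R · E[W_D]`, which is where `ρ` comes from
(`one_sub_mixProb_mul_le`, `mul_subharm_le`, `IsAMMSRun.slot_nonneg`).

To bring a policy `μ` into this form, freeze the deficits at `w₀`; over a frame of length `F` this
costs only a multiple of `F²`. Since AMMS sends earliest deadlines first, an exchange argument on
each link charges every transmission of a rival either to a transmission of AMMS or to a slot where
the rival transmits while the AMMS buffer is nonempty (`card_transmissions_le`). The frozen gain of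
`μ` is therefore at most that of `D ∪ M'`, restricted to nonempty links, summed over the frame. As
`μ` may know the draws of AMMS, it is first replaced by an offline schedule maximising the frozen
gain, which depends on the traffic path alone (`exists_dominating_sets`). The frame length is also a
function of the traffic, so one may work on each event where it takes a given value without biasing
the draws (`IsAMMSRun.horizon_le`, `IsAMMSRun.frame_le`).

This leaves an additive error proportional to `E[F²]`, bounded uniformly because return times of an
irreducible finite chain have geometric tails (`exists_discounted_decay`). The error is negligible
for large `‖w₀‖`: a link with large deficit has an arrival in the frame with probability bounded
below, which forces AMMS itself to gain a lot (`IsAMMSRun.arrival_le`, `ratio_guarantee`). -/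

namespace RTSched

/-! ### The AMMS mixing probabilities for a sorted list of weights -/

section Mixing

variable {R : ℕ} {W : Fin R → ℝ}

lemma nStar_mem (hR : 1 ≤ R) (W : Fin R → ℝ) : 1 ≤ nStar W ∧ nStar W ≤ R ∧
    (nStar W = 1 ∨ ∃ i : Fin R, (i : ℕ) + 1 = nStar W ∧ 0 < W i ∧ 0 ≤ mixProb W (nStar W) i) := by
  classical
  obtain ⟨n, hn, h⟩ := Finset.exists_mem_eq_sup ((Finset.Icc 1 R).filter fun n =>
    n = 1 ∨ ∃ i : Fin R, (i : ℕ) + 1 = n ∧ 0 < W i ∧ 0 ≤ mixProb W n i) ⟨1, by simp [hR]⟩ id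
  have h' : nStar W = n := by
    unfold nStar; rw [id] at h; convert h
  rw [h']
  simp only [Finset.mem_filter, Finset.mem_Icc] at hn
  exact ⟨hn.1.1, hn.1.2, hn.2⟩

lemma le_nStar {n : ℕ} {i : Fin R} (hi : (i : ℕ) + 1 = n) (hW : 0 < W i)
    (hp : 0 ≤ mixProb W n i) : n ≤ nStar W := by
  classical
  unfold nStar
  refine Finset.le_sup (f := id) (b := n) ?_
  simp only [Finset.mem_filter, Finset.mem_Icc]
  exact ⟨⟨by omega, by have := i.2; omega⟩, Or.inr ⟨i, hi, hW, hp⟩⟩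

lemma sum_inv_succ (W : Fin R → ℝ) (j : Fin R) :
    (∑ i : Fin R, if (i : ℕ) < (j : ℕ) + 1 then (W i)⁻¹ else 0) =
      (∑ i : Fin R, if (i : ℕ) < (j : ℕ) then (W i)⁻¹ else 0) + (W j)⁻¹ := by
  have : (W j)⁻¹ = ∑ i : Fin R, if i = j then (W i)⁻¹ else 0 := by simp
  rw [this, ← Finset.sum_add_distrib]
  refine Finset.sum_congr rfl fun i _ => ?_
  by_cases h1 : i = j
  · subst h1; simp
  · have : (i : ℕ) ≠ j := fun h => h1 (Fin.ext h)
    by_cases h2 : (i : ℕ) < j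
    · simp [h1, h2, Nat.lt_succ_of_lt h2]
    · have : ¬ (i : ℕ) < j + 1 := by omega
      simp [h1, h2, this]

lemma subharm_nonneg (h0 : ∀ i, 0 ≤ W i) {n : ℕ} (hn : 1 ≤ n) : 0 ≤ subharm W n := by
  unfold subharm
  have : (1 : ℝ) ≤ n := by exact_mod_cast hn
  refine div_nonneg (by linarith) (Finset.sum_nonneg fun i _ => ?_)
  split_ifs
  · exact inv_nonneg.2 (h0 i)
  · exact le_rfl

/-- Maximality of `n = nStar W`: the condition `C_{n+1} ≤ W_{n+1}` is equivalent to `C_n ≤ W_{n+1}`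
after clearing denominators, so a next weight above `C_n` would make `n + 1` admissible. With
indices from `0`, that next weight sits at index `n`. -/
lemma le_subharm_nStar (hR : 1 ≤ R) (hW : Antitone W) (h0 : ∀ i, 0 ≤ W i) {j : Fin R}
    (hj : nStar W ≤ j) : W j ≤ subharm W (nStar W) := by
  obtain ⟨h1, -, -⟩ := nStar_mem hR W
  set n := nStar W with hn
  have hnR : n < R := lt_of_le_of_lt hj j.2
  let i : Fin R := ⟨n, hnR⟩
  have hji : W j ≤ W i := hW (show i ≤ j from hj)
  refine hji.trans ?_
  rcases (h0 i).eq_or_lt with hi | hi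
  · rw [← hi]; exact subharm_nonneg h0 h1
  by_contra! hlt
  have hpos : ∀ k : Fin R, (k : ℕ) < n → 0 < W k := fun k hk =>
    hi.trans_le (hW (show k ≤ i from hk.le))
  have hS : 0 < ∑ k : Fin R, if (k : ℕ) < n then (W k)⁻¹ else 0 := by
    refine Finset.sum_pos' (fun k _ => ?_) ⟨⟨0, by omega⟩, Finset.mem_univ _, ?_⟩
    · split_ifs with h
      · exact (inv_pos.2 (hpos k h)).le
      · exact le_rfl
    · have h : ((⟨0, by omega⟩ : Fin R) : ℕ) < n := by simp; omega
      rw [if_pos h]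
      exact inv_pos.2 (hpos _ h)
  have hle : n + 1 ≤ nStar W := by
    refine le_nStar (i := i) rfl hi ?_
    have hin : (i : ℕ) < n + 1 := Nat.lt_succ_self n
    rw [mixProb, if_pos hin, sub_nonneg, div_le_one hi]
    unfold subharm at hlt ⊢
    have := sum_inv_succ W i
    rw [show (i : ℕ) = n from rfl] at this
    rw [this]
    rw [div_lt_iff₀ hS] at hlt
    rw [div_le_iff₀ (by positivity)]
    push_cast
    rw [mul_add, mul_inv_cancel₀ hi.ne']
    linarith
  omega

/-- The form `p_i = 1 - C / W_i` is chosen to make `(1 - p_i) W_i = C` for every positive weight in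
the mixture; a weight outside it is itself at most `C`. -/
lemma one_sub_mixProb_mul_le (hR : 1 ≤ R) (hW : Antitone W) (h0 : ∀ i, 0 ≤ W i) (j : Fin R) :
    (1 - mixProb W (nStar W) j) * W j ≤ subharm W (nStar W) := by
  by_cases hj : (j : ℕ) < nStar W
  · rw [mixProb, if_pos hj, sub_sub_cancel]
    rcases (h0 j).eq_or_lt with h | h
    · rw [← h, mul_zero]
      exact subharm_nonneg h0 (nStar_mem hR W).1
    · rw [div_mul_cancel₀ _ h.ne']
  · rw [mixProb, if_neg hj, sub_zero, one_mul]
    exact le_subharm_nStar hR hW h0 (not_lt.1 hj)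

lemma card_filter_lt {n : ℕ} (hn : n ≤ R) :
    (Finset.univ.filter fun i : Fin R => (i : ℕ) < n).card = n := by
  rw [Fin.card_filter_val_lt]; omega

lemma sum_mixProb_nStar (hR : 1 ≤ R) (hW : Antitone W) :
    ∑ i, mixProb W (nStar W) i = 1 := by
  obtain ⟨h1, hnR, h⟩ := nStar_mem hR W
  set n := nStar W
  have hc := card_filter_lt hnR
  simp only [mixProb]
  rw [← Finset.sum_filter, Finset.sum_sub_distrib, Finset.sum_const, hc, nsmul_one]
  simp only [div_eq_mul_inv]
  rw [← Finset.mul_sum]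
  unfold subharm
  rw [← Finset.sum_filter]
  rcases h with h | ⟨i, hi, hWi, -⟩
  · rw [h]; simp
  · have hS : 0 < ∑ k ∈ Finset.univ.filter (fun k : Fin R => (k : ℕ) < n), (W k)⁻¹ := by
      refine Finset.sum_pos (fun k hk => ?_) ⟨i, ?_⟩
      · have hk : (k : ℕ) < n := by simpa using hk
        exact inv_pos.2 (hWi.trans_le (hW (show k ≤ i by rw [Fin.le_def]; omega)))
      · simp; omega
    rw [div_mul_cancel₀ _ hS.ne']
    ring

/-- With `S = ∑ 1 / W_i` over the first `n` weights, the mean weight is `∑ W_i - n C_n`.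
Cauchy–Schwarz gives `∑ W_i ≥ n² / S`, so the mean is at least `n / S`, while `C_n = (n - 1) / S`.
The ratio `(n - 1) / n` is largest at `n = R`. -/
lemma mul_subharm_le (hR : 1 ≤ R) (hW : Antitone W) (h0 : ∀ i, 0 ≤ W i) :
    R * subharm W (nStar W) ≤ (R - 1) * ∑ i, mixProb W (nStar W) i * W i := by
  obtain ⟨h1, hnR, h⟩ := nStar_mem hR W
  have hR' : (1 : ℝ) ≤ R := by exact_mod_cast hR
  set n := nStar W
  rcases h with h | ⟨i, hi, hWi, -⟩
  · have hs : subharm W n = 0 := by simp [subharm, h]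
    rw [hs, mul_zero]
    refine mul_nonneg (by linarith) (Finset.sum_nonneg fun i _ => ?_)
    simp only [mixProb, hs]
    split_ifs
    · simpa using h0 i
    · simp
  · have hc := card_filter_lt hnR
    set T := Finset.univ.filter fun i : Fin R => (i : ℕ) < n with hT
    have hpos : ∀ k ∈ T, 0 < W k := fun k hk => by
      have hk : (k : ℕ) < n := by simpa [hT] using hk
      exact hWi.trans_le (hW (show k ≤ i by rw [Fin.le_def]; omega))
    have hS : 0 < ∑ k ∈ T, (W k)⁻¹ := by
      refine Finset.sum_pos (fun k hk => inv_pos.2 (hpos k hk)) ⟨i, ?_⟩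
      simp [hT]; omega
    have hC : subharm W n = (n - 1) / ∑ k ∈ T, (W k)⁻¹ := by
      rw [subharm, hT, Finset.sum_filter]
    have hA : ∑ i, mixProb W n i * W i = ∑ k ∈ T, W k - n * subharm W n := by
      have : ∀ i, mixProb W n i * W i = if (i : ℕ) < n then W i - subharm W n else 0 := by
        intro k
        by_cases hk : (k : ℕ) < n
        · have := hpos k (by simpa [hT] using hk)
          simp only [mixProb, hk, if_true]
          field_simp
        · simp [mixProb, hk]
      simp only [this]
      rw [← Finset.sum_filter, Finset.sum_sub_distrib, Finset.sum_const, hc, nsmul_eq_mul]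
    have hcs : (n : ℝ) ^ 2 ≤ (∑ k ∈ T, W k) * ∑ k ∈ T, (W k)⁻¹ := by
      have := Finset.sum_sq_le_sum_mul_sum_of_sq_le_mul T (f := W) (g := fun k => (W k)⁻¹)
        (r := fun _ => 1) (fun k hk => (hpos k hk).le) (fun k hk => (inv_pos.2 (hpos k hk)).le)
        (fun k hk => by rw [mul_inv_cancel₀ (hpos k hk).ne', one_pow])
      simpa [hc] using this
    rw [hA, hC]
    set S := ∑ k ∈ T, (W k)⁻¹
    have h2 : (n : ℝ) ^ 2 / S ≤ ∑ k ∈ T, W k := (div_le_iff₀ hS).2 hcs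
    have hn' : (n : ℝ) ≤ R := by exact_mod_cast hnR
    calc (R : ℝ) * ((n - 1) / S) ≤ (R - 1) * (n / S) := by
          rw [← mul_div_assoc, ← mul_div_assoc]
          exact div_le_div_of_nonneg_right (by linarith) hS.le
      _ = (R - 1) * (n ^ 2 / S - n * ((n - 1) / S)) := by ring
      _ ≤ _ := mul_le_mul_of_nonneg_left (by linarith) (by linarith)

end Mixing

/-! ### Exchange argument for earliest-deadline-first on one link -/

section Tail

variable {D : ℕ}

/-- The number of packets with remaining deadline at least `d + 1`. -/
def tail (Ψ : Fin D → ℕ) (d : ℕ) : ℕ := ∑ i : Fin D, if d ≤ i then Ψ i else 0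

lemma tail_add (Ψ Φ : Fin D → ℕ) (d : ℕ) :
    tail (fun i => Ψ i + Φ i) d = tail Ψ d + tail Φ d := by
  simp only [tail, ← Finset.sum_add_distrib]
  refine Finset.sum_congr rfl fun i _ => ?_
  split_ifs <;> simp

lemma tail_anti (Ψ : Fin D → ℕ) {d e : ℕ} (h : d ≤ e) : tail Ψ e ≤ tail Ψ d := by
  refine Finset.sum_le_sum fun i _ => ?_
  split_ifs <;> omega

lemma tail_eq_zero (Ψ : Fin D → ℕ) : tail Ψ D = 0 :=
  Finset.sum_eq_zero fun i _ => if_neg (by have := i.2; omega)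

lemma tail_shift (Ψ : Fin D → ℕ) (d : ℕ) :
    tail (fun i : Fin D => if h : (i : ℕ) + 1 < D then Ψ ⟨i + 1, h⟩ else 0) d
      = tail Ψ (d + 1) := by
  cases D with
  | zero => simp [tail]
  | succ D =>
    unfold tail
    rw [Fin.sum_univ_castSucc, Fin.sum_univ_succ]
    simp
    rfl

lemma tail_remove (Ψ : Fin D → ℕ) (e : Fin D) (he : 0 < Ψ e) (d : ℕ) :
    tail (fun i => Ψ i - if some e = some i then 1 else 0) d + (if d ≤ e then 1 else 0)
      = tail Ψ d := by
  have : (if d ≤ (e : ℕ) then 1 else 0) =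
      ∑ i : Fin D, if i = e then (if d ≤ (i : ℕ) then 1 else 0) else 0 := by
    simp
  rw [this]
  unfold tail
  rw [← Finset.sum_add_distrib]
  refine Finset.sum_congr rfl fun i _ => ?_
  by_cases h : i = e
  · subst h; split_ifs <;> simp at * ; omega
  · simp [h, Ne.symm h]

lemma tail_eq_of_empty_below (Ψ : Fin D → ℕ) {d e : ℕ} (hde : d ≤ e)
    (h : ∀ i : Fin D, (i : ℕ) < e → Ψ i = 0) : tail Ψ d = tail Ψ e := by
  refine Finset.sum_congr rfl fun i _ => ?_
  by_cases hi : (i : ℕ) < e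
  · simp [h i hi]
  · have : e ≤ i := by omega
    simp [this, hde.trans this]

open Classical in
/-- One slot of the comparison of two transmission decisions `i`, `j` on a link, `i` being the
earliest-deadline packet or idle: the surplus of packets in the second buffer is paid for. -/
lemma tail_remove_le {B B' : Fin D → ℕ} {i j : Option (Fin D)} {a b : ℕ}
    (hi : ∀ e, i = some e → 0 < B e ∧ ∀ c < e, B c = 0) (hj : ∀ e, j = some e → 0 < B' e)
    (h : ∀ d, tail B' d + b ≤ tail B d + a) (d : ℕ) :
    tail (fun c => B' c - if j = some c then 1 else 0) d +
        (b + if j ≠ none ∧ ¬ ∃ c, 0 < B c then 1 else 0) ≤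
      tail (fun c => B c - if i = some c then 1 else 0) d +
        (a + if i ≠ none ∧ j = none then 1 else 0) := by
  have hd := h d
  rcases i with _ | e <;> rcases j with _ | f
  · simpa using hd
  · have h1 := tail_remove B' f (hj f rfl) d
    by_cases hB : ∃ c, 0 < B c
    · simp only [ne_eq, reduceCtorEq, not_false_eq_true, hB, not_true, and_false, if_false,
        tsub_zero]
      have h3 : tail (fun c => B c) d = tail B d := rfl
      omega
    · have h2 : ∀ d, tail B d = 0 := fun d => by
        push Not at hB
        exact Finset.sum_eq_zero fun c _ => by simp [Nat.le_zero.1 (hB c)]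
      -- The first buffer is empty, so all its tails vanish. At threshold `0` the packet `f` is
      -- counted for sure, and its removal pays for the new unit in `b`; higher tails are smaller.
      have h3 := tail_remove B' f (hj f rfl) 0
      have h4 := h 0
      have h5 := tail_anti (fun c => B' c - if some f = some c then 1 else 0) (Nat.zero_le d)
      rw [h2] at h4
      have h6 := h2 d
      simp only [ne_eq, reduceCtorEq, not_false_eq_true, hB, and_self, if_true, if_false, not_true,
        tsub_zero, Nat.zero_le] at h3 ⊢
      omega
  · have h1 := tail_remove B e (hi e rfl).1 d
    have : (if d ≤ (e : ℕ) then 1 else 0) ≤ 1 := by split_ifs <;> simp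
    simp only [ne_eq, reduceCtorEq, not_false_eq_true, not_true, false_and, and_self, if_true,
      if_false, tsub_zero]
    have h3 : tail (fun c => B' c) d = tail B' d := rfl
    omega
  · have h1 := tail_remove B e (hi e rfl).1 d
    have h2 := tail_remove B' f (hj f rfl) d
    have hB : ∃ c, 0 < B c := ⟨e, (hi e rfl).1⟩
    have h3 : (if some f ≠ none ∧ ¬ ∃ c, 0 < B c then 1 else 0) = 0 := by simp [hB]
    simp only [h3]
    simp only [reduceCtorEq, and_false, if_false]
    by_cases hde : d ≤ (e : ℕ)
    · by_cases hdf : d ≤ (f : ℕ)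
      · simp only [hde, hdf, if_true] at h1 h2; omega
      -- Here `f < d ≤ e`: removing `e` lowers the first tail at `d`, removing `f` leaves the second
      -- one unchanged. The hypothesis at threshold `f` helps, because the first buffer has nothing
      -- below its earliest packet `e` and so has equal tails at `f` and `d`.
      · have h4 := tail_remove B' f (hj f rfl) f
        have h5 := tail_anti (fun c => B' c - if some f = some c then 1 else 0)
          (show (f : ℕ) ≤ d by omega)
        have h6 := h f
        have h7 : tail B f = tail B d := tail_eq_of_empty_below B (by omega) fun c hc =>
          (hi e rfl).2 c (by rw [Fin.lt_def]; omega)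
        simp only [hde, hdf, if_true, if_false, le_refl] at h1 h2 h4; omega
    · simp only [hde, if_false] at h1; omega

end Tail

/-! ### Buffer comparison and deficit drift along a fixed path -/

namespace Network

variable {K X : Type*} [Fintype K] [Fintype X] [DecidableEq X] (N : Network K X)

/-- The packets left over after the transmissions of slot `t`. -/
def leftover (Ψ₀ : N.Buffer) (w₀ : K → ℝ) (x : ℕ → X) (a : ℕ → K → ℝ) (I : ℕ → N.Schedule)
    (t : ℕ) : N.Buffer :=
  if t = 0 then Ψ₀ else N.remove (N.stateAt Ψ₀ w₀ x a I t).buffer (I t)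

variable {Ψ₀ : N.Buffer} {w₀ : K → ℝ} {x : ℕ → X} {a : ℕ → K → ℝ} {I J : ℕ → N.Schedule}

lemma stateAt_succ_buffer (t : ℕ) : (N.stateAt Ψ₀ w₀ x a I (t + 1)).buffer =
    fun l d => N.age (N.leftover Ψ₀ w₀ x a I t) l d + N.arr (x (t + 1)) l d := by
  cases t <;> simp [stateAt, leftover]

/-- Deficits never feed back into buffers. Feasibility of a fixed schedule thus depends only on
arrivals and earlier decisions, which allows schedules to be replayed with other deficit arrivals
and on a truncated path. -/
lemma stateAt_buffer_congr {w₁ : K → ℝ} {x' : ℕ → X} {a' : ℕ → K → ℝ} {I' : ℕ → N.Schedule}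
    {t : ℕ} (hx : ∀ s, 1 ≤ s → s ≤ t → x s = x' s) (hI : ∀ s, 1 ≤ s → s < t → I s = I' s) :
    (N.stateAt Ψ₀ w₀ x a I t).buffer = (N.stateAt Ψ₀ w₁ x' a' I' t).buffer := by
  induction t with
  | zero => rfl
  | succ t ih =>
    have ih := ih (fun s h1 h2 => hx s h1 (by omega)) (fun s h1 h2 => hI s h1 (by omega))
    rw [stateAt_succ_buffer, stateAt_succ_buffer, hx (t + 1) (by omega) le_rfl]
    have : N.leftover Ψ₀ w₀ x a I t = N.leftover Ψ₀ w₁ x' a' I' t := by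
      unfold leftover
      split_ifs with h
      · rfl
      · rw [ih, hI t (by omega) (by omega)]
    rw [this]

lemma earliest_eq_some {Ψ : Fin N.dmax → ℕ} {e : Fin N.dmax} (h : N.earliest Ψ = some e) :
    0 < Ψ e ∧ ∀ c < e, Ψ c = 0 := by
  unfold earliest at h
  split_ifs at h with hne
  have h := Option.some.inj h
  subst h
  refine ⟨by simpa using Finset.min'_mem _ hne, fun c hc => ?_⟩
  by_contra h0
  exact absurd (Finset.min'_le (Finset.univ.filter fun d => 0 < Ψ d) c (by simp; omega))
    (not_le.2 hc)

lemma earliest_ne_none {Ψ : Fin N.dmax → ℕ} : N.earliest Ψ ≠ none ↔ ∃ d, 0 < Ψ d := by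
  unfold earliest
  split_ifs with h
  · obtain ⟨d, hd⟩ := h
    simp only [ne_eq, reduceCtorEq, not_false_eq_true, true_iff]
    exact ⟨d, by simpa using hd⟩
  · simp only [ne_eq, not_true, false_iff]
    rintro ⟨d, hd⟩
    exact h ⟨d, by simpa using hd⟩

open Classical in
-- Potential argument: at every threshold `d`, the leftover packets of `J` plus the slots where `J`
-- sends while the buffer of `I` is empty are at most the leftover packets of `I` plus the slots
-- where `I` sends and `J` is idle. All thresholds are carried together because ageing shifts them
-- by one.
lemma card_transmissions_le {a' : ℕ → K → ℝ} {w₁ : K → ℝ} {n : ℕ} (l : K)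
    (hI : ∀ t, 1 ≤ t → t ≤ n → ∀ e, I t l = some e →
      0 < (N.stateAt Ψ₀ w₀ x a I t).buffer l e ∧
        ∀ c < e, (N.stateAt Ψ₀ w₀ x a I t).buffer l c = 0)
    (hJ : ∀ t, 1 ≤ t → t ≤ n → ∀ e, J t l = some e →
      0 < (N.stateAt Ψ₀ w₁ x a' J t).buffer l e) :
    ∑ t ∈ Finset.Icc 1 n, (if J t l ≠ none then 1 else 0) ≤
      ∑ t ∈ Finset.Icc 1 n, if I t l ≠ none ∨
        (J t l ≠ none ∧ ∃ d, 0 < (N.stateAt Ψ₀ w₀ x a I t).buffer l d) then 1 else 0 := by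
  set S := N.stateAt Ψ₀ w₀ x a I with hS
  set S' := N.stateAt Ψ₀ w₁ x a' J with hS'
  have key : ∀ m ≤ n, ∀ d, tail (N.leftover Ψ₀ w₁ x a' J m l) d +
      ∑ t ∈ Finset.Icc 1 m, (if J t l ≠ none ∧ ¬ ∃ c, 0 < (S t).buffer l c then 1 else 0) ≤
      tail (N.leftover Ψ₀ w₀ x a I m l) d +
      ∑ t ∈ Finset.Icc 1 m, (if I t l ≠ none ∧ J t l = none then 1 else 0) := by
    intro m
    induction m with
    | zero => intro _ d; simp [leftover]
    | succ m ih =>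
      intro hm d
      have ih := ih (by omega)
      rw [Finset.sum_Icc_succ_top (by omega), Finset.sum_Icc_succ_top (by omega)]
      have hstep : ∀ d, tail ((S' (m + 1)).buffer l) d +
          ∑ t ∈ Finset.Icc 1 m, (if J t l ≠ none ∧ ¬ ∃ c, 0 < (S t).buffer l c then 1 else 0) ≤
          tail ((S (m + 1)).buffer l) d +
          ∑ t ∈ Finset.Icc 1 m, (if I t l ≠ none ∧ J t l = none then 1 else 0) := by
        intro d
        rw [show (S (m + 1)).buffer = _ from N.stateAt_succ_buffer m,
          show (S' (m + 1)).buffer = _ from N.stateAt_succ_buffer m, tail_add, tail_add]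
        have e1 : tail (N.age (N.leftover Ψ₀ w₁ x a' J m) l) d = _ := tail_shift _ d
        have e2 : tail (N.age (N.leftover Ψ₀ w₀ x a I m) l) d = _ := tail_shift _ d
        have := ih (d + 1)
        omega
      simp only [leftover, if_neg (Nat.succ_ne_zero m)]
      exact tail_remove_le (hI (m + 1) (by omega) hm) (hJ (m + 1) (by omega) hm) hstep d
  -- At threshold `dmax` both tails vanish, leaving an inequality between the two slot counts alone.
  have h := key n le_rfl N.dmax
  rw [tail_eq_zero, tail_eq_zero, zero_add, zero_add] at h
  have hpt : ∑ t ∈ Finset.Icc 1 n, (if J t l ≠ none then 1 else 0) +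
      ∑ t ∈ Finset.Icc 1 n, (if I t l ≠ none ∧ J t l = none then 1 else 0) =
      ∑ t ∈ Finset.Icc 1 n, (if I t l ≠ none ∨
        (J t l ≠ none ∧ ∃ d, 0 < (S t).buffer l d) then 1 else 0) +
      ∑ t ∈ Finset.Icc 1 n, (if J t l ≠ none ∧ ¬ ∃ c, 0 < (S t).buffer l c then 1 else 0) := by
    rw [← Finset.sum_add_distrib, ← Finset.sum_add_distrib]
    refine Finset.sum_congr rfl fun t ht => ?_
    rw [Finset.mem_Icc] at ht
    have hne : I t l ≠ none → ∃ d, 0 < (S t).buffer l d := fun h => by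
      obtain ⟨e, he⟩ := Option.ne_none_iff_exists'.1 h
      exact ⟨e, (hI t ht.1 ht.2 e he).1⟩
    by_cases h1 : I t l = none <;> by_cases h2 : J t l = none <;>
      by_cases h3 : ∃ d, 0 < (S t).buffer l d
    all_goals first | exact absurd (hne h1) h3 | simp [h1, h2, h3]
  omega

lemma stateAt_deficit_nonneg (hw : ∀ l, 0 ≤ w₀ l) (t : ℕ) (l : K) :
    0 ≤ (N.stateAt Ψ₀ w₀ x a I t).deficit l := by
  rcases t with _ | _ | t
  · exact hw l
  · exact hw l
  · exact le_max_left _ _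

/-- A deficit rises by at most `amax` and falls by at most `1` per slot. This drift bound is what
permits all gains in a frame to be computed with the frozen vector `w₀`. -/
lemma abs_stateAt_deficit_sub_le (hw : ∀ l, 0 ≤ w₀ l) (ha : ∀ t l, 0 ≤ a t l)
    (ha' : ∀ t l, a t l ≤ N.amax) (t : ℕ) (l : K) :
    |(N.stateAt Ψ₀ w₀ x a I t).deficit l - w₀ l| ≤ t * (N.amax + 1) := by
  have hm : (0 : ℝ) ≤ N.amax := Nat.cast_nonneg _
  induction t with
  | zero => simp [stateAt]
  | succ t ih =>
    rcases t with _ | t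
    · simp only [stateAt, sub_self, abs_zero]; positivity
    · have h0 := N.stateAt_deficit_nonneg (Ψ₀ := Ψ₀) (x := x) (a := a) (I := I) hw (t + 1) l
      simp only [stateAt]
      set s := (N.stateAt Ψ₀ w₀ x a I (t + 1)).deficit l
      have h1 := ha (t + 1) l
      have h2 := ha' (t + 1) l
      have h3 : (0 : ℝ) ≤ (if I (t + 1) l = none then 0 else 1) ∧
        (if I (t + 1) l = none then 0 else 1) ≤ (1 : ℝ) := by split_ifs <;> simp
      have h4 := hw l
      rw [abs_le] at ih ⊢
      push_cast at ih ⊢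
      constructor
      · have := le_max_right 0 (s + a (t + 1) l - if I (t + 1) l = none then 0 else 1)
        linarith
      · have : max 0 (s + a (t + 1) l - if I (t + 1) l = none then 0 else 1) ≤ s + N.amax :=
          max_le (by linarith) (by linarith)
        linarith

end Network

/-! ### Discrete random elements and finite path segments -/

section Discrete

variable {Ω : Type*}

lemma measurable_top_iff {m : MeasurableSpace Ω} {α : Type*} [Countable α] {f : Ω → α} :
    Measurable[m, ⊤] f ↔ ∀ a, MeasurableSet[m] {ω | f ω = a} :=
  ⟨fun h a => h (t := {a}) trivial,
    fun h => @measurable_to_countable' _ _ ⊤ _ m f fun a => h a⟩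

lemma measurable_top_prodMk {m : MeasurableSpace Ω} {α β : Type*} [Countable α] [Countable β]
    {f : Ω → α} {g : Ω → β} (hf : Measurable[m, ⊤] f) (hg : Measurable[m, ⊤] g) :
    Measurable[m, ⊤] fun ω => (f ω, g ω) := by
  refine measurable_top_iff.2 fun a => ?_
  convert (measurable_top_iff.1 hf a.1).inter (measurable_top_iff.1 hg a.2) using 1
  ext ω
  simp [Prod.ext_iff]

lemma measurable_top_pi {m : MeasurableSpace Ω} {ι : Type*} [Finite ι] {α : Type*} [Countable α]
    {f : Ω → ι → α} (hf : ∀ i, Measurable[m, ⊤] fun ω => f ω i) : Measurable[m, ⊤] f := by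
  refine measurable_top_iff.2 fun a => ?_
  convert MeasurableSet.iInter fun i => measurable_top_iff.1 (hf i) (a i) using 1
  ext ω
  simp [funext_iff]

lemma integral_comp_fintype [MeasurableSpace Ω] (P : Measure Ω) [IsFiniteMeasure P] {α : Type*}
    [Fintype α] {f : Ω → α} (hf : Measurable[_, ⊤] f) (F : α → ℝ) :
    ∫ ω, F (f ω) ∂P = ∑ a, P.real {ω | f ω = a} * F a := by
  classical
  have h : ∀ ω, F (f ω) = ∑ a, Set.indicator {ω | f ω = a} (fun _ => F a) ω := by
    intro ω
    simp [Set.indicator_apply]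
  simp only [h]
  rw [integral_finsetSum]
  · refine Finset.sum_congr rfl fun a _ => ?_
    rw [integral_indicator (measurable_top_iff.1 hf a), setIntegral_const, smul_eq_mul]
  · intro a _
    exact (integrable_const _).indicator (measurable_top_iff.1 hf a)

/-- Extension of a finite sequence by its last entry. -/
def extendLast {α : Type*} {n : ℕ} (y : Fin (n + 1) → α) (s : ℕ) : α := y ⟨min s n, by omega⟩

/-- The first `n + 1` entries of a sequence of random elements. -/
def path {α : Type*} (x : ℕ → Ω → α) (n : ℕ) (ω : Ω) : Fin (n + 1) → α := fun i => x i ω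

lemma extendLast_path {α : Type*} (x : ℕ → Ω → α) {n s : ℕ} (h : s ≤ n) (ω : Ω) :
    extendLast (path x n ω) s = x s ω := by
  simp [extendLast, path, min_eq_left h]

lemma path_eq_iff {α : Type*} (x : ℕ → Ω → α) {n : ℕ} (ω : Ω) (y : Fin (n + 1) → α) :
    path x n ω = y ↔ ∀ s ≤ n, x s ω = extendLast y s := by
  constructor
  · rintro rfl s hs
    rw [extendLast_path _ hs]
  · intro h
    funext i
    have := h i (by omega)
    rw [path, this]
    simp [extendLast, min_eq_left (Nat.lt_succ_iff.1 i.2)]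

lemma measurable_path {m : MeasurableSpace Ω} {α : Type*} [Countable α] {x : ℕ → Ω → α}
    (hx : ∀ t, Measurable[m, ⊤] (x t)) (n : ℕ) : Measurable[m, ⊤] (path x n) :=
  measurable_top_pi fun i => hx i

end Discrete

/-! ### Markov property and the discounted number of visits -/

section Chain

variable {K X : Type*} [Fintype K] [Fintype X] [DecidableEq X] {N : Network K X}
variable {Ω : Type*} [MeasurableSpace Ω] {P : Measure Ω} {x₀ : X}
  {x : ℕ → Ω → X}

lemma IsTraffic.real_path_next (h : IsTraffic N P x₀ x) {n : ℕ} (y : Fin (n + 1) → X) (z : X) :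
    P.real {ω | (path x n ω, x (n + 1) ω) = (y, z)} =
      P.real {ω | path x n ω = y} * N.trans (extendLast y n) z := by
  have h1 := h.law n (extendLast y)
  have h2 := h.law (n + 1) fun s => if s ≤ n then extendLast y s else z
  have e1 : {ω | path x n ω = y} = {ω | ∀ s ≤ n, x s ω = extendLast y s} := by
    ext ω; exact path_eq_iff x ω y
  have e2 : {ω | (path x n ω, x (n + 1) ω) = (y, z)} =
      {ω | ∀ s ≤ n + 1, x s ω = if s ≤ n then extendLast y s else z} := by
    ext ω
    simp only [Set.mem_ofPred_eq, Prod.mk.injEq, path_eq_iff]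
    constructor
    · rintro ⟨h1, h2⟩ s hs
      split_ifs with hsn
      · exact h1 s hsn
      · rw [show s = n + 1 by omega, h2]
    · intro h
      refine ⟨fun s hs => ?_, ?_⟩
      · have := h s (by omega)
        rwa [if_pos hs] at this
      · have := h (n + 1) le_rfl
        rwa [if_neg (by omega)] at this
  rw [e1, e2, h1, h2]
  simp only [Nat.zero_le, if_true]
  split_ifs with h0
  · rw [Finset.prod_range_succ]
    congr 1
    · refine Finset.prod_congr rfl fun s hs => ?_
      rw [Finset.mem_range] at hs
      rw [if_pos hs.le, if_pos (show s + 1 ≤ n by omega)]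
    · simp
  · simp

variable [IsProbabilityMeasure P]

lemma IsTraffic.ae_start (h : IsTraffic N P x₀ x) : ∀ᵐ ω ∂P, x 0 ω = x₀ := by
  have h0 := h.law 0 fun _ => x₀
  simp only [Nat.le_zero_eq, forall_eq, Finset.range_zero, Finset.prod_empty, if_true] at h0
  rwa [measureReal_def, ENNReal.toReal_eq_one_iff,
    ← prob_compl_eq_zero_iff (measurable_top_iff.1 (h.meas 0) x₀)] at h0

open Matrix

lemma IsTraffic.integral_next (h : IsTraffic N P x₀ x) {n : ℕ} (φ : (Fin (n + 1) → X) → ℝ)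
    (f : X → ℝ) : ∫ ω, φ (path x n ω) * f (x (n + 1) ω) ∂P =
      ∫ ω, φ (path x n ω) * (N.trans *ᵥ f) (x n ω) ∂P := by
  have m1 := measurable_path h.meas n
  have e1 := integral_comp_fintype P (measurable_top_prodMk m1 (h.meas (n + 1)))
    fun q : (Fin (n + 1) → X) × X => φ q.1 * f q.2
  have e2 := integral_comp_fintype P m1 fun y => φ y * (N.trans *ᵥ f) (extendLast y n)
  simp only [extendLast_path x le_rfl] at e2
  rw [e1, e2, Fintype.sum_prod_type]
  refine Finset.sum_congr rfl fun y _ => ?_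
  simp only [h.real_path_next, mulVec, dotProduct]
  rw [Finset.mul_sum, Finset.mul_sum]
  exact Finset.sum_congr rfl fun z _ => by ring

lemma IsTraffic.integral_later (h : IsTraffic N P x₀ x) {n : ℕ} (φ : (Fin (n + 1) → X) → ℝ)
    (j : ℕ) (f : X → ℝ) : ∫ ω, φ (path x n ω) * f (x (n + j) ω) ∂P =
      ∫ ω, φ (path x n ω) * (N.trans ^ j *ᵥ f) (x n ω) ∂P := by
  induction j generalizing f with
  | zero => simp
  | succ j ih =>
    -- `φ` is viewed as a function of the longer path that ignores the entries after time `n`.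
    have := h.integral_next (n := n + j)
      (fun y => φ fun i => y ⟨i, by omega⟩) f
    rw [pow_succ, ← mulVec_mulVec, ← ih]
    exact this

lemma IsTraffic.real_eq (h : IsTraffic N P x₀ x) (m : ℕ) (y : X) :
    P.real {ω | x m ω = y} = (N.trans ^ m) x₀ y := by
  have h1 := h.integral_later (n := 0) (fun _ => 1) m fun z => if z = y then 1 else 0
  simp only [zero_add, one_mul] at h1
  have e1 := integral_comp_fintype P (h.meas m) fun z => if z = y then 1 else 0
  rw [h1] at e1
  simp only [mul_ite, mul_one, mul_zero, Finset.sum_ite_eq', Finset.mem_univ, if_true] at e1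
  rw [← e1, integral_congr_ae (g := fun _ => (N.trans ^ m) x₀ y)]
  · simp
  · filter_upwards [h.ae_start] with ω hω
    simp [hω, mulVec, dotProduct]

/-- The transition matrix, with a discount by `1 / 2` for each visit to `x₀`. -/
noncomputable def discounted (A : Matrix X X ℝ) (x₀ : X) : Matrix X X ℝ :=
  A * diagonal fun y => if y = x₀ then 1 / 2 else 1

/-- This is the generating function at `1 / 2` of the number of visits to `x₀` during slots `1, …,
n`; the visit at time `0` is not discounted. -/
lemma IsTraffic.integral_discount (h : IsTraffic N P x₀ x) (n : ℕ) (f : X → ℝ) :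
    ∫ ω, (∏ s ∈ Finset.Icc 1 n, if x s ω = x₀ then (1 / 2 : ℝ) else 1) * f (x n ω) ∂P =
      (discounted N.trans x₀ ^ n *ᵥ f) x₀ := by
  induction n generalizing f with
  | zero =>
    rw [integral_congr_ae (g := fun _ => f x₀)]
    · simp
    · filter_upwards [h.ae_start] with ω hω
      simp [hω]
  | succ n ih =>
    rw [pow_succ, ← mulVec_mulVec, ← ih]
    have := h.integral_next (n := n)
      (fun y => ∏ s ∈ Finset.Icc 1 n, if extendLast y s = x₀ then (1 / 2 : ℝ) else 1)
      (diagonal (fun y => if y = x₀ then (1 / 2 : ℝ) else 1) *ᵥ f)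
    have e : ∀ ω, (∏ s ∈ Finset.Icc 1 n,
        if extendLast (path x n ω) s = x₀ then (1 / 2 : ℝ) else 1) =
        ∏ s ∈ Finset.Icc 1 n, if x s ω = x₀ then (1 / 2 : ℝ) else 1 := fun ω =>
      Finset.prod_congr rfl fun s hs => by rw [extendLast_path _ (Finset.mem_Icc.1 hs).2]
    simp only [e] at this
    rw [mulVec_mulVec] at this
    rw [discounted, ← this]
    refine integral_congr_ae (Filter.Eventually.of_forall fun ω => ?_)
    simp only
    rw [Finset.prod_Icc_succ_top (by omega), mulVec_diagonal, mul_assoc]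

end Chain

/-! ### Geometric decay of powers of the discounted matrix -/

section Decay

open Matrix

variable {X : Type*} [Fintype X] [DecidableEq X] {A : Matrix X X ℝ} {x₀ : X}

lemma discounted_apply (i j : X) :
    discounted A x₀ i j = A i j * if j = x₀ then 1 / 2 else 1 := by
  rw [discounted, mul_diagonal]

lemma discounted_pow_nonneg (hA : ∀ i j, 0 ≤ A i j) (n : ℕ) (i j : X) :
    0 ≤ (discounted A x₀ ^ n) i j := by
  refine pow_apply_nonneg (fun i j => ?_) n i j
  rw [discounted_apply]
  have := hA i j
  positivity

lemma discounted_pow_le (hA : ∀ i j, 0 ≤ A i j) (n : ℕ) (i j : X) :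
    (discounted A x₀ ^ n) i j ≤ (A ^ n) i j := by
  induction n generalizing i j with
  | zero => simp
  | succ n ih =>
    rw [pow_succ, pow_succ, mul_apply, mul_apply]
    refine Finset.sum_le_sum fun l _ => mul_le_mul (ih i l) ?_ ?_ (pow_apply_nonneg hA n i l)
    · rw [discounted_apply]
      refine mul_le_of_le_one_right (hA l j) ?_
      split_ifs <;> norm_num
    · simpa using discounted_pow_nonneg (x₀ := x₀) hA 1 l j

lemma discounted_pow_apply_le_half (hA : ∀ i j, 0 ≤ A i j) {n : ℕ} (hn : 0 < n) (i : X) :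
    (discounted A x₀ ^ n) i x₀ ≤ 1 / 2 * (A ^ n) i x₀ := by
  obtain ⟨n, rfl⟩ := Nat.exists_eq_succ_of_ne_zero hn.ne'
  rw [Nat.succ_eq_add_one, pow_succ, pow_succ, mul_apply, mul_apply, Finset.mul_sum]
  refine Finset.sum_le_sum fun l _ => ?_
  rw [discounted_apply, if_pos rfl]
  have := mul_le_mul_of_nonneg_right (discounted_pow_le (x₀ := x₀) hA n i l) (hA l x₀)
  linarith

/-- Only paths that end in `x₀` are considered: their last step alone costs half of their mass, and
the remaining entries do not exceed those of the stochastic matrix `A ^ n`. -/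
lemma discounted_pow_mulVec_one_le (hA : A ∈ rowStochastic ℝ X) {n : ℕ} (hn : 0 < n) (i : X) :
    (discounted A x₀ ^ n *ᵥ 1) i ≤ 1 - 1 / 2 * (A ^ n) i x₀ := by
  have hA0 := (mem_rowStochastic.1 hA).1
  have hs := sum_row_of_mem_rowStochastic (pow_mem hA n) i
  have h1 := discounted_pow_apply_le_half (x₀ := x₀) hA0 hn i
  simp only [mulVec, dotProduct, Pi.one_apply, mul_one]
  rw [← Finset.add_sum_erase _ _ (Finset.mem_univ x₀)] at hs ⊢
  have := Finset.sum_le_sum fun j (_ : j ∈ Finset.univ.erase x₀) =>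
    discounted_pow_le (x₀ := x₀) hA0 n i j
  linarith

lemma discounted_pow_mulVec_mono (hA : ∀ i j, 0 ≤ A i j) (n : ℕ) {f g : X → ℝ}
    (h : ∀ i, f i ≤ g i) (i : X) :
    (discounted A x₀ ^ n *ᵥ f) i ≤ (discounted A x₀ ^ n *ᵥ g) i :=
  Finset.sum_le_sum fun j _ => mul_le_mul_of_nonneg_left (h j) (discounted_pow_nonneg hA n i j)

lemma discounted_pow_mulVec_one_anti (hA : A ∈ rowStochastic ℝ X) (i : X) :
    Antitone fun n => (discounted A x₀ ^ n *ᵥ 1) i := by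
  refine antitone_nat_of_succ_le fun n => ?_
  rw [pow_succ, ← mulVec_mulVec]
  refine discounted_pow_mulVec_mono (mem_rowStochastic.1 hA).1 n (fun j => ?_) i
  have h1 := discounted_pow_mulVec_one_le (x₀ := x₀) hA one_pos j
  have h2 := (mem_rowStochastic.1 hA).1 j x₀
  rw [pow_one] at h1
  rw [pow_one] at h1
  simp only [Pi.one_apply]
  linarith

/-- Irreducibility gives each state `i` a time at which `x₀` is reached with positive probability,
so the row sum at `i` is below `1` by then. Row sums never increase with the power, so one exponent
beyond all these times serves every state. -/
lemma exists_discounted_contraction (hA : A ∈ rowStochastic ℝ X) (hirr : A.IsIrreducible)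
    (x₀ : X) : ∃ m > 0, ∃ θ : ℝ, 0 < θ ∧ θ < 1 ∧ ∀ i, (discounted A x₀ ^ m *ᵥ 1) i ≤ θ := by
  have hA0 := (mem_rowStochastic.1 hA).1
  choose m hm0 hm using fun i => (isIrreducible_iff_exists_pow_pos hA0).1 hirr i x₀
  set M := ∑ i, m i with hM
  have hle : ∀ i, m i ≤ M := fun i => Finset.single_le_sum (fun _ _ => Nat.zero_le _)
    (Finset.mem_univ i)
  obtain ⟨i₁, -, hi₁⟩ := Finset.exists_max_image Finset.univ
    (fun i => (discounted A x₀ ^ M *ᵥ 1) i) ⟨x₀, Finset.mem_univ _⟩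
  -- The maximum with `1 / 2` only keeps `θ` positive, so that its inverse and roots can be used for
  -- the decay rate.
  refine ⟨M, (hm0 x₀).trans_le (hle x₀), max (1 / 2) ((discounted A x₀ ^ M *ᵥ 1) i₁),
    lt_max_of_lt_left (by norm_num), max_lt (by norm_num) ?_,
    fun i => le_max_of_le_right (hi₁ i (Finset.mem_univ _))⟩
  have h1 := discounted_pow_mulVec_one_anti (x₀ := x₀) hA i₁ (hle i₁)
  have h2 := discounted_pow_mulVec_one_le (x₀ := x₀) hA (hm0 i₁) i₁
  have h3 := hm i₁
  simp only at h1
  linarith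

lemma exists_discounted_decay (hA : A ∈ rowStochastic ℝ X) (hirr : A.IsIrreducible) (x₀ : X) :
    ∃ C r : ℝ, 0 < C ∧ 0 < r ∧ r < 1 ∧ ∀ n i, (discounted A x₀ ^ n *ᵥ 1) i ≤ C * r ^ n := by
  obtain ⟨m, hm, θ, hθ0, hθ1, hθ⟩ := exists_discounted_contraction hA hirr x₀
  have hA0 := (mem_rowStochastic.1 hA).1
  have hq : ∀ q i, (discounted A x₀ ^ (m * q) *ᵥ 1) i ≤ θ ^ q := by
    intro q
    induction q with
    | zero => simp
    | succ q ih =>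
      intro i
      rw [Nat.mul_succ, pow_add, ← mulVec_mulVec]
      refine (discounted_pow_mulVec_mono hA0 _ (g := θ • 1) (fun j => ?_) i).trans ?_
      · simpa using hθ j
      · rw [mulVec_smul, Pi.smul_apply, smul_eq_mul, pow_succ']
        exact mul_le_mul_of_nonneg_left (ih i) hθ0.le
  have hr : (θ ^ ((m : ℝ)⁻¹)) ^ m = θ := Real.rpow_inv_natCast_pow hθ0.le hm.ne'
  have hr0 : 0 < θ ^ ((m : ℝ)⁻¹) := Real.rpow_pos_of_pos hθ0 _
  have hr1 : θ ^ ((m : ℝ)⁻¹) < 1 := Real.rpow_lt_one hθ0.le hθ1 (by positivity)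
  refine ⟨θ⁻¹, _, inv_pos.2 hθ0, hr0, hr1, fun n i => ?_⟩
  refine (discounted_pow_mulVec_one_anti hA i (Nat.mul_div_le n m)).trans ((hq _ i).trans ?_)
  rw [← div_eq_inv_mul, le_div_iff₀ hθ0, ← pow_succ]
  calc θ ^ (n / m + 1) = (θ ^ ((m : ℝ)⁻¹)) ^ (m * (n / m + 1)) := by rw [pow_mul, hr]
    _ ≤ (θ ^ ((m : ℝ)⁻¹)) ^ n := pow_le_pow_of_le_one hr0.le hr1.le
        (Nat.lt_mul_div_succ n hm).le

end Decay

/-! ### Second moment of the frame length and arrivals within a frame -/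

section Frame

open Matrix

section Visits

variable {X : Type*} [DecidableEq X] {Ω : Type*} {x₀ : X} {x : ℕ → Ω → X}

/-- `Nat.nth` returns the default `0` when there are too few visits, so only a nonzero value
certifies a genuine `k`-th return, recognisable from the path up to that time. -/
lemma frameLength_eq_iff {k n : ℕ} (hn : n ≠ 0) (ω : Ω) :
    frameLength x₀ x k ω = n ↔ x n ω = x₀ ∧ Nat.count (fun t => x t ω = x₀) n = k := by
  constructor
  · intro h
    unfold frameLength at h
    have h0 : Nat.nth (fun t => x t ω = x₀) k ≠ 0 := by rwa [h]
    have h1 := Nat.nth_mem_of_ne_zero h0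
    rw [h] at h1
    refine ⟨h1, ?_⟩
    have h2 := Nat.count_nth fun hf => Nat.lt_card_toFinset_of_nth_ne_zero h0 hf
    rwa [h] at h2
  · rintro ⟨h1, h2⟩
    rw [frameLength, ← h2]
    exact Nat.nth_count (p := fun t => x t ω = x₀) h1

lemma half_pow_count_le (k n : ℕ) (ω : Ω) (h : Nat.count (fun t => x t ω = x₀) (n + 1) ≤ k) :
    (1 / 2 : ℝ) ^ k ≤ ∏ s ∈ Finset.Icc 1 n, if x s ω = x₀ then (1 / 2 : ℝ) else 1 := by
  rw [Finset.prod_ite, Finset.prod_const, Finset.prod_const_one, mul_one]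
  refine pow_le_pow_of_le_one (by norm_num) (by norm_num) (le_trans ?_ h)
  rw [Nat.count_eq_card_filter_range]
  refine Finset.card_le_card fun s hs => ?_
  simp only [Finset.mem_filter, Finset.mem_Icc, Finset.mem_range] at hs ⊢
  exact ⟨by omega, hs.2⟩

lemma count_path {m n : ℕ} (h : n ≤ m + 1) (ω : Ω) :
    Nat.count (fun t => extendLast (path x m ω) t = x₀) n = Nat.count (fun t => x t ω = x₀) n := by
  rw [Nat.count_eq_card_filter_range, Nat.count_eq_card_filter_range]
  congr 1
  refine Finset.filter_congr fun t ht => ?_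
  rw [extendLast_path x (by rw [Finset.mem_range] at ht; omega)]

variable [Fintype X]

lemma measurable_frameLength {m : MeasurableSpace Ω} (hx : ∀ t, Measurable[m, ⊤] (x t)) (k : ℕ) :
    Measurable[m, ⊤] (frameLength x₀ x k) := by
  have hpos : ∀ n ≠ 0, MeasurableSet[m] {ω | frameLength x₀ x k ω = n} := by
    intro n hn
    have : {ω | frameLength x₀ x k ω = n} =
        path x n ⁻¹' {y | extendLast y n = x₀ ∧
          Nat.count (fun t => extendLast y t = x₀) n = k} := by
      ext ω
      simp only [Set.mem_ofPred_eq, Set.mem_preimage, frameLength_eq_iff hn,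
        extendLast_path x le_rfl]
      rw [count_path n.le_succ]
    rw [this]
    exact measurable_path hx n trivial
  refine measurable_top_iff.2 fun n => ?_
  rcases eq_or_ne n 0 with rfl | hn
  · have : {ω | frameLength x₀ x k ω = 0} =
        (⋃ n : {n : ℕ // n ≠ 0}, {ω | frameLength x₀ x k ω = n})ᶜ := by
      ext ω
      simp only [ne_eq, Set.mem_ofPred_eq, Set.mem_compl_iff, Set.mem_iUnion, not_exists,
        Subtype.forall]
      exact ⟨fun h a ha h' => ha (h'.symm.trans h), fun h => by
        by_contra h'; exact h _ h' rfl⟩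
    rw [this]
    exact (MeasurableSet.iUnion fun n : {n : ℕ // n ≠ 0} => hpos n n.2).compl
  · exact hpos n hn

end Visits

variable {K X : Type*} [Fintype K] [Fintype X] [DecidableEq X] {N : Network K X}
variable {Ω : Type*} [MeasurableSpace Ω] {P : Measure Ω} [IsProbabilityMeasure P] {x₀ : X}
  {x : ℕ → Ω → X}

/-- Markov's inequality for the discount: with at most `k` visits among the slots `0, …, n`, the
discount is at least `2⁻ᵏ`. -/
lemma IsTraffic.real_count_le (h : IsTraffic N P x₀ x) (k n : ℕ) :
    P.real {ω | Nat.count (fun t => x t ω = x₀) (n + 1) ≤ k} ≤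
      2 ^ k * (discounted N.trans x₀ ^ n *ᵥ 1) x₀ := by
  have e := h.integral_discount n 1
  simp only [Pi.one_apply, mul_one] at e
  rw [← e]
  set D : Ω → ℝ := fun ω => ∏ s ∈ Finset.Icc 1 n, if x s ω = x₀ then (1 / 2 : ℝ) else 1 with hD
  have hD0 : ∀ ω, 0 ≤ D ω := fun ω => Finset.prod_nonneg fun s _ => by split_ifs <;> norm_num
  have hD1 : ∀ ω, D ω ≤ 1 := fun ω =>
    Finset.prod_le_one (fun s _ => by split_ifs <;> norm_num) fun s _ => by split_ifs <;> norm_num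
  have hDm : Measurable D := by
    refine Finset.measurable_fun_prod _ fun s _ => ?_
    exact (measurable_from_top (f := fun y : X => if y = x₀ then (1 / 2 : ℝ) else 1)).comp
      (h.meas s)
  have hDi : Integrable D P := Integrable.of_bound hDm.aestronglyMeasurable 1
    (Filter.Eventually.of_forall fun ω => by
      rw [Real.norm_of_nonneg (hD0 ω)]; exact hD1 ω)
  have hm := mul_meas_ge_le_integral_of_nonneg (Filter.Eventually.of_forall hD0) hDi ((1 / 2) ^ k)
  have hsub : P.real {ω | Nat.count (fun t => x t ω = x₀) (n + 1) ≤ k} ≤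
      P.real {ω | (1 / 2) ^ k ≤ D ω} :=
    measureReal_mono fun ω hω => half_pow_count_le k n ω hω
  calc _ ≤ P.real {ω | (1 / 2) ^ k ≤ D ω} := hsub
    _ = 2 ^ k * ((1 / 2) ^ k * P.real {ω | (1 / 2) ^ k ≤ D ω}) := by
        rw [← mul_assoc, ← mul_pow]; norm_num
    _ ≤ _ := mul_le_mul_of_nonneg_left hm (by positivity)

/-- The square of the frame length is integrable, uniformly over all realizations of the traffic. -/
lemma exists_integral_frameLength_sq_le (N : Network K X) (x₀ : X) (k : ℕ) :
    ∃ T : ℝ, 0 ≤ T ∧ ∀ (Ω : Type*) [MeasurableSpace Ω] (P : Measure Ω) [IsProbabilityMeasure P]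
      (x : ℕ → Ω → X), IsTraffic N P x₀ x →
      Integrable (fun ω => (frameLength x₀ x k ω : ℝ) ^ 2) P ∧
        ∫ ω, (frameLength x₀ x k ω : ℝ) ^ 2 ∂P ≤ T := by
  obtain ⟨C, r, hC, hr0, hr1, hCr⟩ := exists_discounted_decay N.stochastic N.irreducible x₀
  -- The factor `r⁻¹` absorbs a shift: frame length `n + 1` is compared with the discount up to time
  -- `n`. The default value `0` of the frame length contributes nothing to the second moment.
  set b : ℕ → ℝ := fun n => (n : ℝ) ^ 2 * (2 ^ k * C * r⁻¹ * r ^ n) with hb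
  have hb0 : ∀ n, 0 ≤ b n := fun n => by positivity
  have hbs : Summable b := by
    have := (summable_pow_mul_geometric_of_norm_lt_one 2 (r := r)
      (by rwa [Real.norm_of_nonneg hr0.le])).mul_left (2 ^ k * C * r⁻¹)
    refine this.congr fun n => ?_
    simp only [hb]; ring
  refine ⟨∑' n, b n, tsum_nonneg hb0, fun Ω _ P _ x h => ?_⟩
  have hF := measurable_frameLength (x₀ := x₀) h.meas k
  have hP : ∀ n : ℕ, (n : ℝ) ^ 2 * P.real {ω | frameLength x₀ x k ω = n} ≤ b n := by
    intro n
    rcases Nat.eq_zero_or_pos n with rfl | hn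
    · simp [hb]
    refine mul_le_mul_of_nonneg_left ?_ (by positivity)
    obtain ⟨n, rfl⟩ := Nat.exists_eq_succ_of_ne_zero hn.ne'
    calc P.real {ω | frameLength x₀ x k ω = n + 1}
        ≤ P.real {ω | Nat.count (fun t => x t ω = x₀) (n + 1) ≤ k} :=
          measureReal_mono fun ω hω => Nat.le_nth_of_count_le (le_of_eq hω.symm)
      _ ≤ 2 ^ k * (C * r ^ n) := (h.real_count_le k n).trans
          (mul_le_mul_of_nonneg_left (hCr n x₀) (by positivity))
      _ = 2 ^ k * C * r⁻¹ * r ^ (n + 1) := by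
          rw [pow_succ]; field_simp
  have hl : ∫⁻ ω, ENNReal.ofReal ((frameLength x₀ x k ω : ℝ) ^ 2) ∂P ≤
      ENNReal.ofReal (∑' n, b n) := by
    rw [← lintegral_map (μ := P) (f := fun n : ℕ => ENNReal.ofReal ((n : ℝ) ^ 2))
      (g := frameLength x₀ x k) measurable_from_top hF, lintegral_countable',
      ENNReal.ofReal_tsum_of_nonneg hb0 hbs]
    refine ENNReal.tsum_le_tsum fun n => ?_
    rw [Measure.map_apply hF (measurableSet_singleton n)]
    have e : P (frameLength x₀ x k ⁻¹' {n}) =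
        ENNReal.ofReal (P.real {ω | frameLength x₀ x k ω = n}) := by
      rw [ofReal_measureReal]; rfl
    rw [e, ← ENNReal.ofReal_mul (by positivity)]
    exact ENNReal.ofReal_le_ofReal (hP n)
  have hmeas : Measurable fun ω => (frameLength x₀ x k ω : ℝ) ^ 2 :=
    (measurable_from_top (f := fun n : ℕ => (n : ℝ) ^ 2)).comp hF
  have hint : Integrable (fun ω => (frameLength x₀ x k ω : ℝ) ^ 2) P := by
    refine ⟨hmeas.aestronglyMeasurable, ?_⟩
    rw [hasFiniteIntegral_iff_ofReal (Filter.Eventually.of_forall fun ω => by positivity)]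
    exact hl.trans_lt ENNReal.ofReal_lt_top
  refine ⟨hint, ?_⟩
  rw [integral_eq_lintegral_of_nonneg_ae (Filter.Eventually.of_forall fun ω => by positivity)
    hmeas.aestronglyMeasurable]
  exact ENNReal.toReal_le_of_le_ofReal (tsum_nonneg hb0) hl

lemma IsTraffic.ae_exists_lt_count (h : IsTraffic N P x₀ x) (k : ℕ) :
    ∀ᵐ ω ∂P, ∃ n, k < Nat.count (fun t => x t ω = x₀) n := by
  obtain ⟨C, r, hC, hr0, hr1, hCr⟩ := exists_discounted_decay N.stochastic N.irreducible x₀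
  have h0 : P.real {ω | ¬ ∃ n, k < Nat.count (fun t => x t ω = x₀) n} ≤ 0 := by
    have hlim : Filter.Tendsto (fun n : ℕ => 2 ^ k * (C * r ^ n)) Filter.atTop (nhds 0) := by
      simpa using ((tendsto_pow_atTop_nhds_zero_of_lt_one hr0.le hr1).const_mul C).const_mul (2 ^ k)
    refine ge_of_tendsto' hlim fun n => ?_
    refine le_trans (measureReal_mono fun ω hω => ?_) ((h.real_count_le k n).trans
          (mul_le_mul_of_nonneg_left (hCr n x₀) (by positivity)))
    simp only [Set.mem_ofPred_eq, not_exists, not_lt] at hω ⊢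
    exact hω (n + 1)
  rw [ae_iff]
  exact (measureReal_eq_zero_iff).1 (le_antisymm h0 measureReal_nonneg)

/-- Every link has arrivals in the frame with a probability that is bounded away from zero. -/
lemma exists_le_real_arrival (N : Network K X) (x₀ : X) {k : ℕ} (hk : 1 ≤ k) (l : K) :
    ∃ q : ℝ, 0 < q ∧ ∀ (Ω : Type*) [MeasurableSpace Ω] (P : Measure Ω) [IsProbabilityMeasure P]
      (x : ℕ → Ω → X), IsTraffic N P x₀ x →
      q ≤ P.real {ω | ∃ t, 1 ≤ t ∧ t ≤ frameLength x₀ x k ω ∧ ∃ d, 0 < N.arr (x t ω) l d} := by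
  classical
  obtain ⟨y, d, hd⟩ := N.arr_pos l
  have hA0 := (mem_rowStochastic.1 N.stochastic).1
  -- Take the least positive `m` for which `y` is reachable from `x₀` in `m` steps. A path at `y` at
  -- time `m` almost surely has not revisited `x₀` strictly in between, since that would give a
  -- shorter connection. So `m` does not exceed the first return time, hence lies in the frame as `k
  -- ≥ 1`.
  have hex := (isIrreducible_iff_exists_pow_pos hA0).1 N.irreducible x₀ y
  have hm := Nat.find_spec hex
  have hmin := fun s => Nat.find_min (H := hex) (m := s)
  set m := Nat.find hex
  refine ⟨(N.trans ^ m) x₀ y, hm.2, fun Ω _ P _ x h => ?_⟩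
  rw [← h.real_eq]
  have hno : ∀ᵐ ω ∂P, ∀ s, 0 < s → s < m → ¬ (x s ω = x₀ ∧ x m ω = y) := by
    rw [ae_all_iff]; intro s
    by_cases hs : 0 < s ∧ s < m
    · have h0 : (N.trans ^ (m - s)) x₀ y = 0 := by
        have h1 := hmin (m - s) (by omega)
        have h2 := pow_apply_nonneg hA0 (m - s) x₀ y
        by_contra hne
        exact h1 ⟨by omega, lt_of_le_of_ne h2 (Ne.symm hne)⟩
      have h1 := h.integral_later (n := s) (fun z => if extendLast z s = x₀ then 1 else 0) (m - s)
        fun z => if z = y then 1 else 0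
      simp only [extendLast_path x le_rfl] at h1
      rw [show s + (m - s) = m by omega] at h1
      have h2 : ∀ ω, (if x s ω = x₀ then (1 : ℝ) else 0) *
          (N.trans ^ (m - s) *ᵥ fun z => if z = y then 1 else 0) (x s ω) = 0 := by
        intro ω
        split_ifs with hx
        · rw [hx]; simp [mulVec, dotProduct, h0]
        · simp
      simp only [h2, integral_zero] at h1
      have hset : MeasurableSet {ω | x s ω = x₀ ∧ x m ω = y} :=
        (measurable_top_iff.1 (h.meas s) x₀).inter (measurable_top_iff.1 (h.meas m) y)
      have h3 : ∀ ω, (if x s ω = x₀ then (1 : ℝ) else 0) * (if x m ω = y then 1 else 0) =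
          Set.indicator {ω | x s ω = x₀ ∧ x m ω = y} (fun _ => 1) ω := by
        intro ω
        simp only [Set.indicator_apply, Set.mem_ofPred_eq]
        split_ifs <;> simp_all
      simp only [h3] at h1
      rw [integral_indicator hset, setIntegral_const, smul_eq_mul, mul_one,
        measureReal_eq_zero_iff] at h1
      have : ∀ᵐ ω ∂P, ¬ (x s ω = x₀ ∧ x m ω = y) := by
        rw [ae_iff]; simpa using h1
      filter_upwards [this] with ω hω _ _ using hω
    · exact Filter.Eventually.of_forall fun ω h1 h2 => absurd ⟨h1, h2⟩ hs
  refine ENNReal.toReal_mono (measure_ne_top _ _) (measure_mono_ae ?_)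
  filter_upwards [h.ae_start, hno, h.ae_exists_lt_count k] with ω hω0 hωno hωk hωy
  have hωy : x m ω = y := hωy
  change ∃ t, 1 ≤ t ∧ t ≤ frameLength x₀ x k ω ∧ ∃ d, 0 < N.arr (x t ω) l d
  refine ⟨m, hm.1, ?_, d, by rwa [hωy]⟩
  obtain ⟨n, hn⟩ := hωk
  -- More than `k` visits occur, so the `k`-th return is a real visit and not the default value of
  -- `Nat.nth`.
  have hcard : ∀ hf : (Set.ofPred fun t => x t ω = x₀).Finite, k < hf.toFinset.card := by
    intro hf
    refine hn.trans_le ?_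
    rw [Nat.count_eq_card_filter_range]
    refine Finset.card_le_card fun t ht => ?_
    simpa using (Finset.mem_filter.1 ht).2
  have h1 := Nat.nth_mem k hcard
  have h2 : Nat.nth (fun t => x t ω = x₀) 0 < Nat.nth (fun t => x t ω = x₀) k :=
    Nat.nth_lt_nth' (by omega) hcard
  by_contra hlt
  exact hωno _ ((Nat.zero_le _).trans_lt h2) (not_le.1 hlt) ⟨h1, hωy⟩

end Frame

/-! ### Dominating sets and pathwise comparison of gains -/

namespace Network

variable {K X : Type*} [Fintype K] [Fintype X] [DecidableEq X] (N : Network K X)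

lemma exists_MIS_superset (s : Set K) (hs : N.graph.IsIndepSet s) :
    ∃ M : N.MIS, ∀ l ∈ s, l ∈ M.1 := by
  classical
  obtain ⟨M, hM, hmax⟩ := Finite.exists_le_maximal
    (p := fun s : Finset K => N.graph.IsIndepSet s) (a := s.toFinite.toFinset) (by simpa using hs)
  exact ⟨⟨M, hmax⟩, fun l hl => hM (by simpa using hl)⟩

instance : Nonempty N.MIS :=
  ⟨(N.exists_MIS_superset ∅ (by simp [SimpleGraph.IsIndepSet])).choose⟩

noncomputable instance fintypeMIS : Fintype N.MIS := Fintype.ofFinite _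

lemma one_le_numMIS : 1 ≤ N.numMIS := Nat.card_pos

open Classical in
lemma weight_eq (S : N.State) (M : N.MIS) : N.weight S M =
    ∑ l, if l ∈ M.1 ∧ ∃ d, 0 < S.buffer l d then S.deficit l else 0 := by
  rw [weight, ← Finset.sum_filter]
  refine Finset.sum_congr ?_ fun _ _ => rfl
  ext l
  simp

lemma weight_nonneg {S : N.State} (hS : ∀ l, 0 ≤ S.deficit l) (M : N.MIS) : 0 ≤ N.weight S M :=
  Finset.sum_nonneg fun l _ => hS l

lemma edfSchedule_ne_none {Ψ : N.Buffer} {M : N.MIS} {l : K} :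
    N.edfSchedule Ψ M l ≠ none ↔ l ∈ M.1 ∧ ∃ d, 0 < Ψ l d := by
  classical
  by_cases h : l ∈ M.1 <;> simp [edfSchedule, h, ← N.earliest_ne_none]

lemma gain_edfSchedule (S : N.State) (M : N.MIS) :
    N.gain S (N.edfSchedule S.buffer M) = N.weight S M := by
  classical
  rw [gain, weight_eq]
  refine Finset.sum_congr rfl fun l _ => ?_
  have h := N.edfSchedule_ne_none (Ψ := S.buffer) (M := M) (l := l)
  by_cases h0 : N.edfSchedule S.buffer M l = none
  · rw [if_pos h0, if_neg fun h1 => h.2 h1 h0]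
  · rw [if_neg h0, if_pos (h.1 h0)]

lemma edfSchedule_eq_some {Ψ : N.Buffer} {M : N.MIS} {l : K} {e : Fin N.dmax}
    (h : N.edfSchedule Ψ M l = some e) : 0 < Ψ l e ∧ ∀ c < e, Ψ l c = 0 := by
  unfold edfSchedule at h
  split_ifs at h
  exact N.earliest_eq_some h

lemma sum_ammsProb {ord : N.State → Fin N.numMIS ≃ N.MIS} (hord : N.IsWeightOrder ord)
    (S : N.State) : ∑ M, N.ammsProb ord S M = 1 := by
  rw [← (ord S).sum_comp]
  simp only [ammsProb, Equiv.symm_apply_apply]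
  exact sum_mixProb_nStar N.one_le_numMIS (hord S)

/-- The one-slot guarantee: the expected weight lost by missing any prescribed set is at most `(R -
1) / R` times the expected weight collected. -/
lemma one_sub_ammsProb_mul_weight_le {ord : N.State → Fin N.numMIS ≃ N.MIS}
    (hord : N.IsWeightOrder ord) {S : N.State} (hS : ∀ l, 0 ≤ S.deficit l) (M' : N.MIS) :
    N.numMIS * ((1 - N.ammsProb ord S M') * N.weight S M') ≤
      (N.numMIS - 1) * ∑ M, N.ammsProb ord S M * N.weight S M := by
  rw [← (ord S).sum_comp]
  simp only [ammsProb, Equiv.symm_apply_apply]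
  have h0 : ∀ i, 0 ≤ N.weight S (ord S i) := fun i => N.weight_nonneg hS _
  have h1 := one_sub_mixProb_mul_le N.one_le_numMIS (hord S) h0 ((ord S).symm M')
  rw [Equiv.apply_symm_apply] at h1
  exact (mul_le_mul_of_nonneg_left h1 (Nat.cast_nonneg _)).trans
    (mul_subharm_le N.one_le_numMIS (hord S) h0)

variable {Ψ₀ : N.Buffer} {w₀ : K → ℝ}

lemma sum_sum_ite_le_of_card_le {n : ℕ} {p q : ℕ → K → Prop} [∀ t l, Decidable (p t l)]
    [∀ t l, Decidable (q t l)] (hw : ∀ l, 0 ≤ w₀ l)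
    (h : ∀ l, (∑ t ∈ Finset.Icc 1 n, if p t l then 1 else 0) ≤
      ∑ t ∈ Finset.Icc 1 n, if q t l then 1 else 0) :
    (∑ t ∈ Finset.Icc 1 n, ∑ l, if p t l then w₀ l else 0) ≤
      ∑ t ∈ Finset.Icc 1 n, ∑ l, if q t l then w₀ l else 0 := by
  rw [Finset.sum_comm, Finset.sum_comm (s := Finset.Icc 1 n)]
  refine Finset.sum_le_sum fun l _ => ?_
  have e : ∀ (r : ℕ → K → Prop) [∀ t l, Decidable (r t l)],
      (∑ t ∈ Finset.Icc 1 n, if r t l then w₀ l else 0) =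
      w₀ l * ((∑ t ∈ Finset.Icc 1 n, if r t l then 1 else 0 : ℕ) : ℝ) := by
    intro r _
    rw [Nat.cast_sum, Finset.mul_sum]
    refine Finset.sum_congr rfl fun t _ => ?_
    split_ifs <;> simp
  rw [e p, e q]
  exact mul_le_mul_of_nonneg_left (by exact_mod_cast h l) (hw l)

open Classical in
/-- For every traffic path there is a sequence of maximal independent sets, not depending on
the random selections, against which every feasible sequence of decisions can be compared. -/
lemma exists_dominating_sets (Ψ₀ : N.Buffer) (hw : ∀ l, 0 ≤ w₀ l) (n : ℕ) :
    ∃ M' : (Fin (n + 1) → X) → ℕ → N.MIS, ∀ (y : Fin (n + 1) → X) (x : ℕ → X)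
      (a : ℕ → K → ℝ) (I J : ℕ → N.Schedule) (D : ℕ → N.MIS),
      (∀ s ≤ n, x s = extendLast y s) →
      (∀ t, 1 ≤ t → I t = N.edfSchedule (N.stateAt Ψ₀ w₀ x a I t).buffer (D t)) →
      (∀ t, 1 ≤ t → N.Feasible (N.stateAt Ψ₀ w₀ x a J t).buffer (J t)) →
      (∑ t ∈ Finset.Icc 1 n, ∑ l, if J t l ≠ none then w₀ l else 0) ≤
        ∑ t ∈ Finset.Icc 1 n, ∑ l, if I t l ≠ none ∨
          (l ∈ (M' y t).1 ∧ ∃ d, 0 < (N.stateAt Ψ₀ w₀ x a I t).buffer l d) then w₀ l else 0 := by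
  suffices h : ∀ y : Fin (n + 1) → X, ∃ M' : ℕ → N.MIS, ∀ (x : ℕ → X)
      (a : ℕ → K → ℝ) (I J : ℕ → N.Schedule) (D : ℕ → N.MIS),
      (∀ s ≤ n, x s = extendLast y s) →
      (∀ t, 1 ≤ t → I t = N.edfSchedule (N.stateAt Ψ₀ w₀ x a I t).buffer (D t)) →
      (∀ t, 1 ≤ t → N.Feasible (N.stateAt Ψ₀ w₀ x a J t).buffer (J t)) →
      (∑ t ∈ Finset.Icc 1 n, ∑ l, if J t l ≠ none then w₀ l else 0) ≤
        ∑ t ∈ Finset.Icc 1 n, ∑ l, if I t l ≠ none ∨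
          (l ∈ (M' t).1 ∧ ∃ d, 0 < (N.stateAt Ψ₀ w₀ x a I t).buffer l d) then w₀ l else 0 by
    choose M' hM' using h
    exact ⟨M', hM'⟩
  intro y
  -- The schedules feasible along `y` up to slot `n` form a finite set. Deficit arrivals are set to
  -- `0`, since feasibility does not see them.
  let Φ := {J : Fin (n + 1) → N.Schedule // ∀ t, 1 ≤ t → t ≤ n → N.Feasible
    (N.stateAt Ψ₀ w₀ (extendLast y) (fun _ _ => 0) (extendLast J) t).buffer (extendLast J t)}
  have hΦ : ∀ (x : ℕ → X) (a : ℕ → K → ℝ) (J : ℕ → N.Schedule), (∀ s ≤ n, x s = extendLast y s) →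
      (∀ t, 1 ≤ t → N.Feasible (N.stateAt Ψ₀ w₀ x a J t).buffer (J t)) →
      ∃ J' : Φ, ∀ t ≤ n, extendLast J'.1 t = J t := by
    intro x a J hx hJ
    have e : ∀ t ≤ n, extendLast (fun i : Fin (n + 1) => J i) t = J t := fun t ht => by
      simp [extendLast, min_eq_left ht]
    refine ⟨⟨fun i => J i, fun t h1 h2 => ?_⟩, e⟩
    rw [e t h2, N.stateAt_buffer_congr (w₁ := w₀) (x' := x) (a' := a) (I' := J)
      (fun s _ hs => (hx s (hs.trans h2)).symm) (fun s _ hs => e s (hs.le.trans h2))]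
    exact hJ t h1
  rcases isEmpty_or_nonempty Φ with hemp | hne
  · refine ⟨fun _ => Classical.arbitrary _, fun x a I J D hx hI hJ => ?_⟩
    exact (hemp.false (hΦ x a J hx hJ).choose).elim
  have : Finite Φ := Subtype.finite
  -- A maximiser of the frozen gain depends on `y` only, although the schedule it dominates may
  -- react to the draws of AMMS. Its transmitting links extend to the sets `M'`.
  obtain ⟨J₀, hJ₀⟩ := Finite.exists_max fun J : Φ =>
    ∑ t ∈ Finset.Icc 1 n, ∑ l, if extendLast J.1 t l ≠ none then w₀ l else 0
  have hM : ∀ t, ∃ M : N.MIS, 1 ≤ t → t ≤ n → ∀ l, extendLast J₀.1 t l ≠ none → l ∈ M.1 := by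
    intro t
    by_cases ht : 1 ≤ t ∧ t ≤ n
    · obtain ⟨M, hM⟩ := N.exists_MIS_superset _ (J₀.2 t ht.1 ht.2).2
      exact ⟨M, fun _ _ => hM⟩
    · exact ⟨Classical.arbitrary _, fun h1 h2 => absurd ⟨h1, h2⟩ ht⟩
  choose M' hM' using hM
  refine ⟨M', fun x a I J D hx hI hJ => ?_⟩
  obtain ⟨J', hJ'⟩ := hΦ x a J hx hJ
  calc (∑ t ∈ Finset.Icc 1 n, ∑ l, if J t l ≠ none then w₀ l else 0)
      = ∑ t ∈ Finset.Icc 1 n, ∑ l, if extendLast J'.1 t l ≠ none then w₀ l else 0 :=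
        Finset.sum_congr rfl fun t ht => by rw [hJ' t (Finset.mem_Icc.1 ht).2]
    _ ≤ ∑ t ∈ Finset.Icc 1 n, ∑ l, if extendLast J₀.1 t l ≠ none then w₀ l else 0 := hJ₀ J'
    _ ≤ ∑ t ∈ Finset.Icc 1 n, ∑ l, if I t l ≠ none ∨ (extendLast J₀.1 t l ≠ none ∧
          ∃ d, 0 < (N.stateAt Ψ₀ w₀ x a I t).buffer l d) then w₀ l else 0 := by
        refine sum_sum_ite_le_of_card_le hw fun l => ?_
        convert N.card_transmissions_le (Ψ₀ := Ψ₀) (w₀ := w₀) (w₁ := w₀) (x := x) (a := a)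
          (a' := fun _ _ => 0) (I := I) (J := extendLast J₀.1) (n := n) l
          (fun t h1 _ e he => N.edfSchedule_eq_some (M := D t) (by rw [← hI t h1]; exact he))
          (fun t h1 h2 e he => ?_)
        have := (J₀.2 t h1 h2).1 l e he
        rwa [N.stateAt_buffer_congr (w₁ := w₀) (x' := x) (a' := fun _ _ => 0)
          (I' := extendLast J₀.1) (fun s _ hs => (hx s (hs.trans h2)).symm)
          (fun s _ hs => rfl)] at this
    _ ≤ _ := by
        refine Finset.sum_le_sum fun t ht => Finset.sum_le_sum fun l _ => ?_
        rw [Finset.mem_Icc] at ht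
        split_ifs with h1 h2 h2
        · exact le_rfl
        · exact absurd (h1.imp_right fun h => ⟨hM' t ht.1 ht.2 l h.1, h.2⟩) h2
        · exact hw l
        · exact le_rfl

open Classical in
/-- Comparison of the gain of a feasible sequence of decisions with the weights of the sets
selected by AMMS and of the dominating sets, up to the variation of the deficits in the frame. -/
lemma frameGain_le_of_dominating {x : ℕ → X} {a : ℕ → K → ℝ} {I J : ℕ → N.Schedule}
    {D M' : ℕ → N.MIS} {n : ℕ} (hw : ∀ l, 0 ≤ w₀ l) (ha : ∀ t l, 0 ≤ a t l)
    (ha' : ∀ t l, a t l ≤ N.amax)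
    (hI : ∀ t, 1 ≤ t → I t = N.edfSchedule (N.stateAt Ψ₀ w₀ x a I t).buffer (D t))
    (hM' : (∑ t ∈ Finset.Icc 1 n, ∑ l, if J t l ≠ none then w₀ l else 0) ≤
        ∑ t ∈ Finset.Icc 1 n, ∑ l, if I t l ≠ none ∨
          (l ∈ (M' t).1 ∧ ∃ d, 0 < (N.stateAt Ψ₀ w₀ x a I t).buffer l d) then w₀ l else 0) :
    N.frameGain Ψ₀ w₀ x a J n ≤ ∑ t ∈ Finset.Icc 1 n,
        (N.weight (N.stateAt Ψ₀ w₀ x a I t) (D t) +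
          if D t = M' t then 0 else N.weight (N.stateAt Ψ₀ w₀ x a I t) (M' t)) +
      2 * (Fintype.card K * (N.amax + 1)) * (n : ℝ) ^ 2 := by
  have hb : ∀ (I : ℕ → N.Schedule) t, t ∈ Finset.Icc 1 n → ∀ l,
      |(N.stateAt Ψ₀ w₀ x a I t).deficit l - w₀ l| ≤ n * (N.amax + 1) := by
    intro I t ht l
    refine (N.abs_stateAt_deficit_sub_le hw ha ha' t l).trans ?_
    have : (t : ℝ) ≤ n := by exact_mod_cast (Finset.mem_Icc.1 ht).2
    gcongr
  have hc : ∀ c : ℝ, ∑ t ∈ Finset.Icc 1 n, ∑ _l : K, c = n * (Fintype.card K * c) := by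
    intro c; simp
  -- Deficits are exchanged twice, from those of `J` to `w₀` and from `w₀` to those of `I`; this
  -- explains the factor `2` in the error.
  have h1 : N.frameGain Ψ₀ w₀ x a J n ≤
      (∑ t ∈ Finset.Icc 1 n, ∑ l, if J t l ≠ none then w₀ l else 0) +
        n * (Fintype.card K * (n * (N.amax + 1))) := by
    rw [← hc, ← Finset.sum_add_distrib]
    refine Finset.sum_le_sum fun t ht => ?_
    rw [← Finset.sum_add_distrib]
    refine Finset.sum_le_sum fun l _ => ?_
    have := (abs_le.1 (hb J t ht l)).2
    split_ifs with h h'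
    · exact absurd h h'
    · positivity
    · linarith
  have h2 : (∑ t ∈ Finset.Icc 1 n, ∑ l, if I t l ≠ none ∨
          (l ∈ (M' t).1 ∧ ∃ d, 0 < (N.stateAt Ψ₀ w₀ x a I t).buffer l d) then w₀ l else 0) ≤
      ∑ t ∈ Finset.Icc 1 n, (N.weight (N.stateAt Ψ₀ w₀ x a I t) (D t) +
          if D t = M' t then 0 else N.weight (N.stateAt Ψ₀ w₀ x a I t) (M' t)) +
        n * (Fintype.card K * (n * (N.amax + 1))) := by
    rw [← hc, ← Finset.sum_add_distrib]
    refine Finset.sum_le_sum fun t ht => ?_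
    -- When `D t = M' t` the union is a single set and its weight is counted once. Without this
    -- saving the union bound would only lead to the ratio `1 / 2`.
    have hif : (if D t = M' t then 0 else N.weight (N.stateAt Ψ₀ w₀ x a I t) (M' t)) =
        ∑ l, if D t = M' t then 0 else if l ∈ (M' t).1 ∧
          ∃ d, 0 < (N.stateAt Ψ₀ w₀ x a I t).buffer l d then
          (N.stateAt Ψ₀ w₀ x a I t).deficit l else 0 := by
      split_ifs
      · simp
      · exact N.weight_eq _ _
    rw [weight_eq, hif, ← Finset.sum_add_distrib, ← Finset.sum_add_distrib]
    refine Finset.sum_le_sum fun l _ => ?_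
    have h3 := (abs_le.1 (hb I t ht l)).1
    have h4 := N.stateAt_deficit_nonneg (Ψ₀ := Ψ₀) (x := x) (a := a) (I := I) hw t l
    have h5 : (0 : ℝ) ≤ n * (N.amax + 1) := by positivity
    have h6 : I t l ≠ none ↔ l ∈ (D t).1 ∧
        ∃ d, 0 < (N.stateAt Ψ₀ w₀ x a I t).buffer l d := by
      rw [hI t (Finset.mem_Icc.1 ht).1]; exact N.edfSchedule_ne_none
    have h7 : l ∈ (D t).1 → D t = M' t → l ∈ (M' t).1 := fun h e => e ▸ h
    have h8 : l ∈ (M' t).1 → D t = M' t → l ∈ (D t).1 := fun h e => e ▸ h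
    simp only [h6]
    set S := N.stateAt Ψ₀ w₀ x a I t
    by_cases c1 : ∃ d, 0 < S.buffer l d
    · by_cases c2 : l ∈ (D t).1 <;> by_cases c3 : l ∈ (M' t).1 <;> by_cases c4 : D t = M' t
      all_goals first
        | exact absurd (h7 c2 c4) c3
        | exact absurd (h8 c3 c4) c2
        | (simp only [c1, c2, c3, c4, and_true, or_true, true_or, or_self, if_true, if_false,
            and_self]; linarith)
    · simp only [c1, and_false, or_self, if_false, ite_self]
      linarith
  calc _ ≤ _ := h1
    _ ≤ _ := by
      refine (add_le_add_left (hM'.trans h2) _).trans (le_of_eq ?_)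
      ring

lemma frameGain_eq_sum_weight {x : ℕ → X} {a : ℕ → K → ℝ} {I : ℕ → N.Schedule}
    {D : ℕ → N.MIS} (hI : ∀ t, 1 ≤ t → I t = N.edfSchedule (N.stateAt Ψ₀ w₀ x a I t).buffer (D t))
    (n : ℕ) : N.frameGain Ψ₀ w₀ x a I n =
      ∑ t ∈ Finset.Icc 1 n, N.weight (N.stateAt Ψ₀ w₀ x a I t) (D t) := by
  refine Finset.sum_congr rfl fun t ht => ?_
  conv_lhs => rw [hI t (Finset.mem_Icc.1 ht).1]
  rw [← gain_edfSchedule]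

lemma frameGain_nonneg {x : ℕ → X} {a : ℕ → K → ℝ} {I : ℕ → N.Schedule} (hw : ∀ l, 0 ≤ w₀ l)
    (n : ℕ) : 0 ≤ N.frameGain Ψ₀ w₀ x a I n := by
  refine Finset.sum_nonneg fun t _ => Finset.sum_nonneg fun l _ => ?_
  split_ifs
  · exact le_rfl
  · exact N.stateAt_deficit_nonneg hw t l

lemma frameGain_le {x : ℕ → X} {a : ℕ → K → ℝ} {I : ℕ → N.Schedule} (hw : ∀ l, 0 ≤ w₀ l)
    (ha : ∀ t l, 0 ≤ a t l) (ha' : ∀ t l, a t l ≤ N.amax) (n : ℕ) :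
    N.frameGain Ψ₀ w₀ x a I n ≤
      (∑ l, w₀ l + Fintype.card K * (N.amax + 1)) * (n : ℝ) ^ 2 := by
  have h0 : 0 ≤ ∑ l, w₀ l := Finset.sum_nonneg fun l _ => hw l
  calc N.frameGain Ψ₀ w₀ x a I n ≤
      ∑ t ∈ Finset.Icc 1 n, ∑ l, (w₀ l + n * (N.amax + 1)) := by
        refine Finset.sum_le_sum fun t ht => Finset.sum_le_sum fun l _ => ?_
        have h1 := (abs_le.1 (N.abs_stateAt_deficit_sub_le (Ψ₀ := Ψ₀) (x := x) (I := I)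
          hw ha ha' t l)).2
        have h2 : (t : ℝ) ≤ n := by exact_mod_cast (Finset.mem_Icc.1 ht).2
        have h3 : (t : ℝ) * (N.amax + 1) ≤ n * (N.amax + 1) := by gcongr
        have h4 : (0 : ℝ) ≤ n * (N.amax + 1) := by positivity
        have h5 := hw l
        split_ifs <;> linarith
    _ = n * (∑ l, w₀ l) + Fintype.card K * (N.amax + 1) * (n : ℝ) ^ 2 := by
        simp [Finset.sum_add_distrib]; ring
    _ ≤ n ^ 2 * (∑ l, w₀ l) + Fintype.card K * (N.amax + 1) * (n : ℝ) ^ 2 := by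
        gcongr
        exact_mod_cast Nat.le_self_pow two_ne_zero n
    _ = _ := by ring

end Network

/-! ### Random selection with prescribed conditional probabilities -/

section General

variable {Ω : Type*}

lemma measurable_top_comp {m : MeasurableSpace Ω} {α β : Type*} {g : Ω → α}
    (hg : Measurable[m, ⊤] g) (f : α → β) : Measurable[m, ⊤] fun ω => f (g ω) :=
  fun s _ => hg (t := f ⁻¹' s) trivial

lemma measurable_eval_top {m : MeasurableSpace Ω} {α : Type*} [Countable α] {D : Ω → α}
    (hD : Measurable[m, ⊤] D) {f : α → Ω → ℝ} (hf : ∀ M, Measurable[m] (f M)) :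
    Measurable[m] fun ω => f (D ω) ω := by
  let : MeasurableSpace α := ⊤
  have h : Measurable fun q : Ω × α => f q.2 q.1 := measurable_from_prod_countable_left hf
  exact h.comp (measurable_id.prodMk hD)

/-- Selection of a random index with prescribed conditional probabilities. -/
lemma integral_eval_nonneg {m mΩ : MeasurableSpace Ω} (hm : m ≤ mΩ) {P : Measure Ω}
    [IsProbabilityMeasure P] {α : Type*} [Fintype α] {D : Ω → α} (hD : Measurable[mΩ, ⊤] D)
    {q : α → Ω → ℝ} (hq : ∀ M, P⟦{ω | D ω = M} | m⟧ =ᵐ[P] q M) {c : α → Ω → ℝ} {C : ℝ}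
    (hc : ∀ M, Measurable[m] (c M)) (hC : ∀ M ω, |c M ω| ≤ C)
    (h : ∀ ω, 0 ≤ ∑ M, q M ω * c M ω) : 0 ≤ ∫ ω, c (D ω) ω ∂P := by
  classical
  have hset : ∀ M, MeasurableSet {ω | D ω = M} := measurable_top_iff.1 hD
  have hcm : ∀ M, StronglyMeasurable[m] (c M) := fun M => (hc M).stronglyMeasurable
  have hind : ∀ M, Integrable (Set.indicator {ω | D ω = M} fun _ => (1 : ℝ)) P := fun M =>
    (integrable_const _).indicator (hset M)
  have hci : ∀ M, Integrable (c M) P := fun M =>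
    Integrable.of_bound ((hcm M).mono hm).aestronglyMeasurable C
      (Filter.Eventually.of_forall fun ω => hC M ω)
  have hmul : ∀ M, Integrable (c M * Set.indicator {ω | D ω = M} fun _ => (1 : ℝ)) P := by
    intro M
    refine ((hci M).indicator (hset M)).congr (Filter.Eventually.of_forall fun ω => ?_)
    by_cases hω : D ω = M <;> simp [hω]
  have hpull : ∀ M, P[c M * Set.indicator {ω | D ω = M} (fun _ => (1 : ℝ)) | m] =ᵐ[P]
      fun ω => q M ω * c M ω := by
    intro M
    refine (condExp_mul_of_stronglyMeasurable_left (hcm M) (hmul M) (hind M)).trans ?_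
    filter_upwards [hq M] with ω hω
    rw [Pi.mul_apply, hω, mul_comm]
  have e : ∀ ω, c (D ω) ω =
      ∑ M, (c M * Set.indicator {ω | D ω = M} fun _ => (1 : ℝ)) ω := by
    intro ω
    simp [Set.indicator_apply]
  simp only [e]
  rw [integral_finsetSum _ fun M _ => hmul M]
  have e2 : ∀ M, ∫ ω, (c M * Set.indicator {ω | D ω = M} fun _ => (1 : ℝ)) ω ∂P =
      ∫ ω, q M ω * c M ω ∂P := by
    intro M
    rw [← integral_condExp hm, integral_congr_ae (hpull M)]
  simp only [e2]
  rw [← integral_finsetSum]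
  · exact integral_nonneg h
  · exact fun M _ => integrable_condExp.congr (hpull M)

end General

/-! ### Measurability of states and gains, for the ambient and the past σ-algebras -/

section Measurability

variable {K X : Type*} [Fintype K] [Fintype X] [DecidableEq X] {N : Network K X}
variable {Ω : Type*} {Ψ₀ : N.Buffer} {w₀ : K → ℝ}
  {x : ℕ → Ω → X} {a : ℕ → Ω → K → ℝ} {D : ℕ → Ω → N.MIS} {I : ℕ → Ω → N.Schedule}

lemma measurable_buffer {m : MeasurableSpace Ω} (hx : ∀ t, Measurable[m, ⊤] (x t)) {t : ℕ}
    (hI : ∀ s, 1 ≤ s → s < t → Measurable[m, ⊤] (I s)) :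
    Measurable[m, ⊤] fun ω => (N.stateAt Ψ₀ w₀ (fun s => x s ω) (fun s => a s ω)
      (fun s => I s ω) t).buffer := by
  induction t with
  | zero => exact measurable_const
  | succ t ih =>
    have ih := ih fun s h1 h2 => hI s h1 (by omega)
    simp only [Network.stateAt_succ_buffer, Network.leftover]
    rcases Nat.eq_zero_or_pos t with rfl | ht
    · exact measurable_top_comp (hx 1) fun y l d => N.age Ψ₀ l d + N.arr y l d
    · simp only [if_neg ht.ne']
      exact measurable_top_comp (measurable_top_prodMk (measurable_top_prodMk ih
        (hI t ht (by omega))) (hx (t + 1))) fun q l d =>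
          N.age (N.remove q.1.1 q.1.2) l d + N.arr q.2 l d

lemma measurable_deficit {m : MeasurableSpace Ω} (ha : ∀ t, Measurable[m] (a t)) {t : ℕ}
    (hI : ∀ s, 1 ≤ s → s < t → Measurable[m, ⊤] (I s)) (l : K) :
    Measurable[m] fun ω => (N.stateAt Ψ₀ w₀ (fun s => x s ω) (fun s => a s ω)
      (fun s => I s ω) t).deficit l := by
  induction t with
  | zero => exact measurable_const
  | succ t ih =>
    have ih := ih fun s h1 h2 => hI s h1 (by omega)
    rcases t with _ | t
    · exact measurable_const
    · simp only [Network.stateAt]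
      refine measurable_const.max ((ih.add ((measurable_pi_apply l).comp (ha (t + 1)))).sub ?_)
      exact (measurable_from_top (f := fun J : N.Schedule => if J l = none then (0 : ℝ) else 1)).comp
        (hI (t + 1) (by omega) (by omega))

lemma measurable_weight {m : MeasurableSpace Ω} (hx : ∀ t, Measurable[m, ⊤] (x t))
    (ha : ∀ t, Measurable[m] (a t)) {t : ℕ}
    (hI : ∀ s, 1 ≤ s → s < t → Measurable[m, ⊤] (I s)) (M : N.MIS) :
    Measurable[m] fun ω => N.weight (N.stateAt Ψ₀ w₀ (fun s => x s ω) (fun s => a s ω)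
      (fun s => I s ω) t) M := by
  classical
  simp only [Network.weight_eq]
  refine Finset.measurable_fun_sum _ fun l _ => ?_
  have h1 := (measurable_from_top (f := fun Ψ : N.Buffer =>
    if l ∈ M.1 ∧ ∃ d, 0 < Ψ l d then (1 : ℝ) else 0)).comp
      (measurable_buffer (N := N) (Ψ₀ := Ψ₀) (w₀ := w₀) (a := a) hx hI)
  convert h1.mul (measurable_deficit (Ψ₀ := Ψ₀) (w₀ := w₀) (x := x) ha hI l) using 1
  funext ω
  simp

lemma measurable_gain {m : MeasurableSpace Ω} (ha : ∀ t, Measurable[m] (a t)) {t : ℕ}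
    (ht : 1 ≤ t) (hI : ∀ s, 1 ≤ s → Measurable[m, ⊤] (I s)) :
    Measurable[m] fun ω => N.gain (N.stateAt Ψ₀ w₀ (fun s => x s ω) (fun s => a s ω)
      (fun s => I s ω) t) (I t ω) := by
  refine Finset.measurable_fun_sum _ fun l _ => ?_
  have h1 := (measurable_from_top (f := fun J : N.Schedule =>
    if J l = none then (0 : ℝ) else 1)).comp (hI t ht)
  convert h1.mul (measurable_deficit (Ψ₀ := Ψ₀) (w₀ := w₀) (x := x) (t := t) ha
    (fun s h _ => hI s h) l) using 1
  funext ω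
  simp

lemma measurable_frameGain {m : MeasurableSpace Ω} {x₀ : X} (hx : ∀ t, Measurable[m, ⊤] (x t))
    (ha : ∀ t, Measurable[m] (a t)) (hI : ∀ s, 1 ≤ s → Measurable[m, ⊤] (I s)) (k : ℕ) :
    Measurable[m] fun ω => N.frameGain Ψ₀ w₀ (fun s => x s ω) (fun s => a s ω)
      (fun s => I s ω) (frameLength x₀ x k ω) :=
  measurable_eval_top (measurable_frameLength hx k)
    (f := fun n ω => N.frameGain Ψ₀ w₀ (fun s => x s ω) (fun s => a s ω) (fun s => I s ω) n)
    fun _ => Finset.measurable_fun_sum _ fun _ ht => measurable_gain ha (Finset.mem_Icc.1 ht).1 hI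

/-- The decisions of AMMS are determined by the traffic and the selections. -/
lemma measurable_edf_decision {m : MeasurableSpace Ω} (hx : ∀ t, Measurable[m, ⊤] (x t)) {t : ℕ}
    (hI : ∀ t ≥ 1, ∀ ω, I t ω = N.edfSchedule
      (N.stateAt Ψ₀ w₀ (fun s => x s ω) (fun s => a s ω) (fun s => I s ω) t).buffer (D t ω))
    (hD : ∀ s, 1 ≤ s → s < t → Measurable[m, ⊤] (D s)) (s : ℕ) (hs1 : 1 ≤ s) (hst : s < t) :
    Measurable[m, ⊤] (I s) := by
  induction s using Nat.strong_induction_on with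
  | _ s ih =>
    have hb := measurable_buffer (N := N) (Ψ₀ := Ψ₀) (w₀ := w₀) (a := a) (I := I) hx (t := s)
      fun r h1 h2 => ih r h2 h1 (h2.trans hst)
    rw [funext (hI s hs1)]
    exact measurable_top_comp (measurable_top_prodMk hb (hD s hs1 hst))
      fun q => N.edfSchedule q.1 q.2

variable {mΩ : MeasurableSpace Ω}

lemma ammsPast_le (hx : ∀ t, Measurable[mΩ, ⊤] (x t)) (ha : ∀ t, Measurable (a t))
    (hD : ∀ t, Measurable[mΩ, ⊤] (D t)) (t : ℕ) : ammsPast N x a D t ≤ mΩ :=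
  sup_le (sup_le (iSup_le fun s => (hx s).comap_le) (iSup_le fun s => (ha s).comap_le))
    (iSup₂_le fun s _ => (hD s).comap_le)

lemma traffic_le_ammsPast (t : ℕ) :
    (⨆ s, MeasurableSpace.comap (x s) ⊤) ≤ ammsPast N x a D t :=
  le_sup_left.trans le_sup_left

lemma measurable_ammsPast_traffic (t s : ℕ) : Measurable[ammsPast N x a D t, ⊤] (x s) :=
  measurable_iff_comap_le.2
    ((le_iSup (fun s => MeasurableSpace.comap (x s) ⊤) s).trans (traffic_le_ammsPast t))

lemma measurable_ammsPast_deficit (t s : ℕ) : Measurable[ammsPast N x a D t] (a s) :=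
  measurable_iff_comap_le.2
    ((le_iSup (fun s => MeasurableSpace.comap (a s) inferInstance) s).trans
      (le_sup_right.trans le_sup_left))

lemma measurable_ammsPast_selection (t s : ℕ) (h1 : 1 ≤ s) (h2 : s < t) :
    Measurable[ammsPast N x a D t, ⊤] (D s) :=
  measurable_iff_comap_le.2
    ((le_iSup₂ (f := fun s (_ : s ∈ Finset.Ico 1 t) => MeasurableSpace.comap (D s) ⊤) s
      (Finset.mem_Ico.2 ⟨h1, h2⟩)).trans le_sup_right)

end Measurability

/-! ### The one-slot guarantee in expectation -/

section Slot

variable {K X : Type*} [Fintype K] [Fintype X] [DecidableEq X] {N : Network K X}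
variable {Ω : Type*} [MeasurableSpace Ω] {P : Measure Ω} [IsProbabilityMeasure P]
  {Ψ₀ : N.Buffer} {w₀ : K → ℝ} {p : K → ℝ}
  {x : ℕ → Ω → X} {a : ℕ → Ω → K → ℝ} {D : ℕ → Ω → N.MIS} {I : ℕ → Ω → N.Schedule}
  {ord : N.State → Fin N.numMIS ≃ N.MIS}

lemma abs_weight_le {x : ℕ → X} {a : ℕ → K → ℝ} {I : ℕ → N.Schedule} (hw : ∀ l, 0 ≤ w₀ l)
    (ha : ∀ t l, 0 ≤ a t l) (ha' : ∀ t l, a t l ≤ N.amax) (t : ℕ) (M : N.MIS) :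
    |N.weight (N.stateAt Ψ₀ w₀ x a I t) M| ≤ ∑ l, (w₀ l + t * (N.amax + 1)) := by
  classical
  rw [abs_of_nonneg (N.weight_nonneg (N.stateAt_deficit_nonneg hw t) M), Network.weight_eq]
  refine Finset.sum_le_sum fun l _ => ?_
  have h1 := (abs_le.1 (N.abs_stateAt_deficit_sub_le (Ψ₀ := Ψ₀) (x := x) (I := I)
    hw ha ha' t l)).2
  have h2 := hw l
  have h3 : (0 : ℝ) ≤ t * (N.amax + 1) := by positivity
  split_ifs <;> linarith

open Classical in
/-- The guarantee of AMMS in a single slot against a selection that is determined by the traffic. -/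
lemma IsAMMSRun.slot_nonneg (hw : ∀ l, 0 ≤ w₀ l) (hx : ∀ t, Measurable[_, ⊤] (x t))
    (ha : IsDeficitArrival N P p x a) (hord : N.IsWeightOrder ord)
    (h : IsAMMSRun N P ord Ψ₀ w₀ x a D I) {t : ℕ} (ht : 1 ≤ t) {M' : Ω → N.MIS}
    (hM' : Measurable[ammsPast N x a D t, ⊤] M') {B : Set Ω}
    (hB : MeasurableSet[ammsPast N x a D t] B) :
    0 ≤ ∫ ω in B, ((N.numMIS - 1) * N.weight (N.stateAt Ψ₀ w₀ (fun s => x s ω)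
        (fun s => a s ω) (fun s => I s ω) t) (D t ω) -
      N.numMIS * if D t ω = M' ω then 0 else N.weight (N.stateAt Ψ₀ w₀ (fun s => x s ω)
        (fun s => a s ω) (fun s => I s ω) t) (M' ω)) ∂P := by
  have hm := ammsPast_le (N := N) hx ha.meas h.meas t
  set S : Ω → N.State := fun ω => N.stateAt Ψ₀ w₀ (fun s => x s ω)
        (fun s => a s ω) (fun s => I s ω) t with hS
  have hS0 : ∀ ω l, 0 ≤ (S ω).deficit l := fun ω l => N.stateAt_deficit_nonneg hw t l
  have hW : ∀ M, Measurable[ammsPast N x a D t] fun ω => N.weight (S ω) M := fun M =>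
    measurable_weight (measurable_ammsPast_traffic t) (measurable_ammsPast_deficit t)
      (measurable_edf_decision (measurable_ammsPast_traffic t) h.sched
        (measurable_ammsPast_selection t)) M
  -- `c M` is the integrand as it would be if `M` were drawn. It is known from the past, so
  -- conditionally only the draw `D t` is random.
  set c : N.MIS → Ω → ℝ := fun M => B.indicator fun ω => (N.numMIS - 1) * N.weight (S ω) M -
      N.numMIS * if M = M' ω then 0 else N.weight (S ω) (M' ω) with hc
  have hcm : ∀ M, Measurable[ammsPast N x a D t] (c M) := by
    intro M
    refine Measurable.indicator (((hW M).const_mul _).sub (Measurable.const_mul ?_ _)) hB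
    refine measurable_eval_top hM' (f := fun M₁ ω => if M = M₁ then 0 else N.weight (S ω) M₁)
      fun M₁ => ?_
    by_cases hMM : M = M₁
    · simp [hMM]
    · simpa [hMM] using hW M₁
  have hR : (1 : ℝ) ≤ N.numMIS := by exact_mod_cast N.one_le_numMIS
  set C₀ : ℝ := ∑ l, (w₀ l + t * (N.amax + 1))
  have hb : ∀ ω M, |N.weight (S ω) M| ≤ C₀ := fun ω M =>
    abs_weight_le hw (fun t => ha.nonneg t ω) (fun t => ha.le t ω) t M
  have hC₀ : 0 ≤ C₀ := Finset.sum_nonneg fun l _ => add_nonneg (hw l) (by positivity)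
  have hcC : ∀ M ω, |c M ω| ≤ (N.numMIS - 1) * C₀ + N.numMIS * C₀ := by
    intro M ω
    simp only [hc, Set.indicator_apply]
    split_ifs with h1 h2
    · rw [mul_zero, sub_zero, abs_mul, abs_of_nonneg (by linarith : (0:ℝ) ≤ N.numMIS - 1)]
      have := mul_le_mul_of_nonneg_left (hb ω M) (by linarith : (0:ℝ) ≤ N.numMIS - 1)
      have : 0 ≤ (N.numMIS : ℝ) * C₀ := by positivity
      linarith
    · refine (abs_sub _ _).trans ?_
      rw [abs_mul, abs_mul, abs_of_nonneg (by linarith : (0:ℝ) ≤ N.numMIS - 1),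
        abs_of_nonneg (by linarith : (0:ℝ) ≤ N.numMIS)]
      exact add_le_add (mul_le_mul_of_nonneg_left (hb ω M) (by linarith))
        (mul_le_mul_of_nonneg_left (hb ω (M' ω)) (by linarith))
    · rw [abs_zero]
      exact add_nonneg (mul_nonneg (by linarith) hC₀) (by positivity)
  have key := integral_eval_nonneg hm (h.meas t) (h.law t ht) hcm hcC fun ω => by
    by_cases hω : ω ∈ B
    · simp only [hc, Set.indicator_of_mem hω]
      have h1 := N.sum_ammsProb hord (S ω)
      have h2 := N.one_sub_ammsProb_mul_weight_le hord (hS0 ω) (M' ω)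
      -- The penalty is charged for every draw except `M'`; since the probabilities sum to `1`, its
      -- mean carries the factor `1 - p_{M'}`.
      have h3 : ∑ M, N.ammsProb ord (S ω) M * (if M = M' ω then 0 else N.weight (S ω) (M' ω)) =
          (1 - N.ammsProb ord (S ω) (M' ω)) * N.weight (S ω) (M' ω) := by
        rw [← h1, sub_mul, Finset.sum_mul, eq_sub_iff_add_eq]
        have : N.ammsProb ord (S ω) (M' ω) * N.weight (S ω) (M' ω) =
            ∑ M, if M = M' ω then N.ammsProb ord (S ω) M * N.weight (S ω) (M' ω) else 0 := by
          simp
        rw [this, ← Finset.sum_add_distrib]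
        refine Finset.sum_congr rfl fun M _ => ?_
        split_ifs <;> simp
      have h4 : ∑ M, N.ammsProb ord (S ω) M * ((N.numMIS - 1) * N.weight (S ω) M -
          N.numMIS * if M = M' ω then 0 else N.weight (S ω) (M' ω)) =
          (N.numMIS - 1) * ∑ M, N.ammsProb ord (S ω) M * N.weight (S ω) M -
          N.numMIS * ((1 - N.ammsProb ord (S ω) (M' ω)) * N.weight (S ω) (M' ω)) := by
        rw [← h3, Finset.mul_sum, Finset.mul_sum, ← Finset.sum_sub_distrib]
        exact Finset.sum_congr rfl fun M _ => by ring
      simp only [hS] at h4 h2 ⊢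
      rw [h4]
      linarith
    · simp [hc, Set.indicator_of_notMem hω]
  rw [← integral_indicator (hm _ hB)]
  refine key.trans (le_of_eq (integral_congr_ae (Filter.Eventually.of_forall fun ω => ?_)))
  simp only [hc, Set.indicator_apply, hS]

end Slot

/-! ### From a random horizon to fixed horizons -/

section Fibers

variable {Ω : Type*} [MeasurableSpace Ω] {P : Measure Ω}

lemma integral_le_of_fiber_le {F : Ω → ℕ} (hF : Measurable[_, ⊤] F) {f g : Ω → ℝ}
    (hf : Integrable f P) (hg : Integrable g P)
    (h : ∀ n, ∫ ω in {ω | F ω = n}, f ω ∂P ≤ ∫ ω in {ω | F ω = n}, g ω ∂P) :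
    ∫ ω, f ω ∂P ≤ ∫ ω, g ω ∂P := by
  have hU : ⋃ n, {ω | F ω = n} = Set.univ := by ext ω; simp
  have hd : Pairwise (Function.onFun Disjoint fun n => {ω | F ω = n}) := fun m n hmn =>
    Set.disjoint_left.2 fun ω h1 h2 => hmn (h1.symm.trans h2)
  have key : ∀ f : Ω → ℝ, Integrable f P →
      HasSum (fun n => ∫ ω in {ω | F ω = n}, f ω ∂P) (∫ ω, f ω ∂P) := by
    intro f hf
    have := hasSum_integral_iUnion (μ := P) (f := f) (s := fun n => {ω | F ω = n})
      (measurable_top_iff.1 hF) hd hf.integrableOn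
    rwa [hU, setIntegral_univ] at this
  exact hasSum_le h (key f hf) (key g hg)

end Fibers

lemma measurable_traffic {X Ω : Type*} {x : ℕ → Ω → X} (s : ℕ) :
    Measurable[⨆ s, MeasurableSpace.comap (x s) ⊤, ⊤] (x s) :=
  measurable_iff_comap_le.2 (le_iSup (fun s => MeasurableSpace.comap (x s) ⊤) s)

/-! ### Guarantees over a whole frame -/

section Horizon

variable {K X : Type*} [Fintype K] [Fintype X] [DecidableEq X] {N : Network K X}
variable {Ω : Type*} [MeasurableSpace Ω] {P : Measure Ω}
  {Ψ₀ : N.Buffer} {w₀ : K → ℝ} {p : K → ℝ} {x₀ : X} {k : ℕ}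
  {x : ℕ → Ω → X} {a : ℕ → Ω → K → ℝ} {D : ℕ → Ω → N.MIS} {I J : ℕ → Ω → N.Schedule}
  {ord : N.State → Fin N.numMIS ≃ N.MIS}

lemma IsAMMSRun.measurable_decision (hx : ∀ t, Measurable[_, ⊤] (x t))
    (h : IsAMMSRun N P ord Ψ₀ w₀ x a D I) (s : ℕ) (hs : 1 ≤ s) : Measurable[_, ⊤] (I s) :=
  measurable_edf_decision (t := s + 1) hx h.sched (fun s _ _ => h.meas s) s hs s.lt_succ_self

lemma integrable_frameGain (hw : ∀ l, 0 ≤ w₀ l) (hx : ∀ t, Measurable[_, ⊤] (x t))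
    (ha : IsDeficitArrival N P p x a) (hI : ∀ s, 1 ≤ s → Measurable[_, ⊤] (I s))
    (hF : Integrable (fun ω => (frameLength x₀ x k ω : ℝ) ^ 2) P) :
    Integrable (fun ω => N.frameGain Ψ₀ w₀ (fun s => x s ω) (fun s => a s ω)
      (fun s => I s ω) (frameLength x₀ x k ω)) P := by
  refine (hF.const_mul (∑ l, w₀ l + Fintype.card K * (N.amax + 1))).mono'
    (measurable_frameGain hx ha.meas hI k).aestronglyMeasurable
    (Filter.Eventually.of_forall fun ω => ?_)
  rw [Real.norm_of_nonneg (N.frameGain_nonneg hw _)]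
  exact N.frameGain_le hw (fun t => ha.nonneg t ω) (fun t => ha.le t ω) _

variable [IsProbabilityMeasure P]

lemma integrable_weight (hw : ∀ l, 0 ≤ w₀ l) (hx : ∀ t, Measurable[_, ⊤] (x t))
    (ha : IsDeficitArrival N P p x a) (hI : ∀ s, 1 ≤ s → Measurable[_, ⊤] (I s)) (t : ℕ)
    {M : Ω → N.MIS} (hM : Measurable[_, ⊤] M) :
    Integrable (fun ω => N.weight (N.stateAt Ψ₀ w₀ (fun s => x s ω) (fun s => a s ω)
      (fun s => I s ω) t) (M ω)) P := by
  refine Integrable.of_bound (Measurable.aestronglyMeasurable ?_)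
    (∑ l, (w₀ l + t * (N.amax + 1))) (Filter.Eventually.of_forall fun ω => ?_)
  · exact measurable_eval_top hM (f := fun M ω => N.weight (N.stateAt Ψ₀ w₀ (fun s => x s ω)
      (fun s => a s ω) (fun s => I s ω) t) M)
      fun M => measurable_weight hx ha.meas (fun s h _ => hI s h) M
  · exact abs_weight_le hw (fun t => ha.nonneg t ω) (fun t => ha.le t ω) t _

open Classical in
lemma integrable_weight_of_ne (hw : ∀ l, 0 ≤ w₀ l) (hx : ∀ t, Measurable[_, ⊤] (x t))
    (ha : IsDeficitArrival N P p x a) (hI : ∀ s, 1 ≤ s → Measurable[_, ⊤] (I s)) (t : ℕ)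
    {M M' : Ω → N.MIS} (hM : Measurable[_, ⊤] M) (hM' : Measurable[_, ⊤] M') :
    Integrable (fun ω => if M ω = M' ω then 0 else N.weight (N.stateAt Ψ₀ w₀ (fun s => x s ω)
      (fun s => a s ω) (fun s => I s ω) t) (M' ω)) P := by
  have h := (integrable_weight (Ψ₀ := Ψ₀) hw hx ha hI t hM').indicator
    (s := {ω | (M ω, M' ω) ∈ {q : N.MIS × N.MIS | q.1 ≠ q.2}})
    (measurable_top_prodMk hM hM' (t := {q : N.MIS × N.MIS | q.1 ≠ q.2}) trivial)
  refine h.congr (Filter.Eventually.of_forall fun ω => ?_)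
  by_cases hω : M ω = M' ω <;> simp [hω]

open Classical in
/-- The guarantee of AMMS over a fixed horizon on an event that is determined by the traffic. -/
lemma IsAMMSRun.horizon_le (hw : ∀ l, 0 ≤ w₀ l) (hx : ∀ t, Measurable[_, ⊤] (x t))
    (ha : IsDeficitArrival N P p x a) (hord : N.IsWeightOrder ord)
    (h : IsAMMSRun N P ord Ψ₀ w₀ x a D I) (n : ℕ) {M' : ℕ → Ω → N.MIS}
    (hM' : ∀ t, Measurable[⨆ s, MeasurableSpace.comap (x s) ⊤, ⊤] (M' t)) {B : Set Ω}
    (hB : MeasurableSet[⨆ s, MeasurableSpace.comap (x s) ⊤] B) :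
    N.numMIS * ∫ ω in B, ∑ t ∈ Finset.Icc 1 n, (N.weight (N.stateAt Ψ₀ w₀ (fun s => x s ω)
        (fun s => a s ω) (fun s => I s ω) t) (D t ω) +
        if D t ω = M' t ω then 0 else N.weight (N.stateAt Ψ₀ w₀ (fun s => x s ω)
        (fun s => a s ω) (fun s => I s ω) t) (M' t ω)) ∂P ≤
      (2 * N.numMIS - 1) * ∫ ω in B, N.frameGain Ψ₀ w₀ (fun s => x s ω) (fun s => a s ω)
        (fun s => I s ω) n ∂P := by
  have hTle : (⨆ s, MeasurableSpace.comap (x s) ⊤) ≤ ‹MeasurableSpace Ω› :=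
    iSup_le fun s => (hx s).comap_le
  have hI := h.measurable_decision hx
  have hslot : ∀ t ∈ Finset.Icc 1 n, _ := fun t ht =>
    h.slot_nonneg hw hx ha hord (Finset.mem_Icc.1 ht).1
      ((hM' t).mono (traffic_le_ammsPast (N := N) (a := a) (D := D) t) le_rfl)
      (traffic_le_ammsPast (N := N) (a := a) (D := D) t B hB)
  have i1 : ∀ t, Integrable (fun ω => N.weight (N.stateAt Ψ₀ w₀ (fun s => x s ω)
      (fun s => a s ω) (fun s => I s ω) t) (D t ω)) (P.restrict B) := fun t =>
    (integrable_weight hw hx ha hI t (h.meas t)).restrict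
  have i2 : ∀ t, Integrable (fun ω => if D t ω = M' t ω then 0 else
      N.weight (N.stateAt Ψ₀ w₀ (fun s => x s ω) (fun s => a s ω) (fun s => I s ω) t) (M' t ω))
      (P.restrict B) := fun t =>
    (integrable_weight_of_ne hw hx ha hI t (h.meas t) ((hM' t).mono hTle le_rfl)).restrict
  have i3 : ∀ t, Integrable (fun ω => N.weight (N.stateAt Ψ₀ w₀ (fun s => x s ω)
      (fun s => a s ω) (fun s => I s ω) t) (D t ω) + if D t ω = M' t ω then 0 else
      N.weight (N.stateAt Ψ₀ w₀ (fun s => x s ω) (fun s => a s ω) (fun s => I s ω) t) (M' t ω))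
      (P.restrict B) := fun t => (i1 t).add (i2 t)
  have e : ∀ ω, N.frameGain Ψ₀ w₀ (fun s => x s ω) (fun s => a s ω) (fun s => I s ω) n = _ :=
    fun ω => N.frameGain_eq_sum_weight (D := fun t => D t ω) (fun t ht => h.sched t ht ω) n
  simp only [e]
  rw [integral_finsetSum _ fun t _ => i3 t, integral_finsetSum _ fun t _ => i1 t,
    Finset.mul_sum, Finset.mul_sum]
  refine Finset.sum_le_sum fun t ht => ?_
  have h1 := hslot t ht
  rw [integral_sub ((i1 t).const_mul _) ((i2 t).const_mul _), integral_const_mul,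
    integral_const_mul] at h1
  rw [integral_add (i1 t) (i2 t)]
  linarith

/-- AMMS against a non-causal policy over a frame. -/
lemma IsAMMSRun.frame_le (hw : ∀ l, 0 ≤ w₀ l) (hx : ∀ t, Measurable[_, ⊤] (x t))
    (ha : IsDeficitArrival N P p x a) (hord : N.IsWeightOrder ord)
    (h : IsAMMSRun N P ord Ψ₀ w₀ x a D I) (hJ : IsNonCausalRun N Ψ₀ w₀ x a J)
    (hF : Integrable (fun ω => (frameLength x₀ x k ω : ℝ) ^ 2) P) :
    N.numMIS * ∫ ω, N.frameGain Ψ₀ w₀ (fun s => x s ω) (fun s => a s ω)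
        (fun s => J s ω) (frameLength x₀ x k ω) ∂P ≤
      (2 * N.numMIS - 1) * ∫ ω, N.frameGain Ψ₀ w₀ (fun s => x s ω) (fun s => a s ω)
        (fun s => I s ω) (frameLength x₀ x k ω) ∂P +
      N.numMIS * (2 * (Fintype.card K * (N.amax + 1)) *
        ∫ ω, (frameLength x₀ x k ω : ℝ) ^ 2 ∂P) := by
  classical
  have hI := h.measurable_decision hx
  have iI := integrable_frameGain (Ψ₀ := Ψ₀) (k := k) (x₀ := x₀) hw hx ha hI hF
  have iJ := integrable_frameGain (Ψ₀ := Ψ₀) (k := k) (x₀ := x₀) hw hx ha (fun s _ => hJ.meas s) hF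
  rw [← integral_const_mul, ← integral_const_mul, ← integral_const_mul, ← integral_const_mul,
    ← integral_add (iI.const_mul _) ((hF.const_mul _).const_mul _)]
  refine integral_le_of_fiber_le (measurable_frameLength (x₀ := x₀) hx k) (iJ.const_mul _)
    ((iI.const_mul _).add ((hF.const_mul _).const_mul _)) fun n => ?_
  set B : Set Ω := {ω | frameLength x₀ x k ω = n} with hB
  -- The past of AMMS contains the entire traffic, including the future, so the event that the frame
  -- has length `n` is known in every slot and leaves the law of the draws unchanged.
  have hBT : MeasurableSet[⨆ s, MeasurableSpace.comap (x s) ⊤] B :=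
    measurable_top_iff.1 (measurable_frameLength measurable_traffic k) n
  have hBm : MeasurableSet B := measurable_top_iff.1 (measurable_frameLength hx k) n
  obtain ⟨M₀, hM₀⟩ := N.exists_dominating_sets Ψ₀ hw n
  set M' : ℕ → Ω → N.MIS := fun t ω => M₀ (path x n ω) t with hM'
  have hM'T : ∀ t, Measurable[⨆ s, MeasurableSpace.comap (x s) ⊤, ⊤] (M' t) := fun t =>
    measurable_top_comp (measurable_path measurable_traffic n) fun y => M₀ y t
  have hM'm : ∀ t, Measurable[_, ⊤] (M' t) := fun t =>
    measurable_top_comp (measurable_path hx n) fun y => M₀ y t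
  have hmain := h.horizon_le hw hx ha hord n hM'T hBT
  have hpt : ∀ ω ∈ B, N.frameGain Ψ₀ w₀ (fun s => x s ω) (fun s => a s ω)
        (fun s => J s ω) (frameLength x₀ x k ω) ≤
      ∑ t ∈ Finset.Icc 1 n, (N.weight (N.stateAt Ψ₀ w₀ (fun s => x s ω)
        (fun s => a s ω) (fun s => I s ω) t) (D t ω) +
        if D t ω = M' t ω then 0 else N.weight (N.stateAt Ψ₀ w₀ (fun s => x s ω)
        (fun s => a s ω) (fun s => I s ω) t) (M' t ω)) +
      2 * (Fintype.card K * (N.amax + 1)) * (frameLength x₀ x k ω : ℝ) ^ 2 := by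
    intro ω hω
    rw [show frameLength x₀ x k ω = n from hω]
    exact N.frameGain_le_of_dominating (D := fun t => D t ω) (M' := fun t => M' t ω) hw
      (fun t => ha.nonneg t ω) (fun t => ha.le t ω) (fun t ht => h.sched t ht ω)
      (hM₀ (path x n ω) _ _ _ _ (fun t => D t ω) (fun s hs => (extendLast_path x hs ω).symm)
        (fun t ht => h.sched t ht ω) fun t ht => hJ.feasible t ht ω)
  have iS : Integrable (fun ω => ∑ t ∈ Finset.Icc 1 n, (N.weight (N.stateAt Ψ₀ w₀ (fun s => x s ω)
        (fun s => a s ω) (fun s => I s ω) t) (D t ω) +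
        if D t ω = M' t ω then 0 else N.weight (N.stateAt Ψ₀ w₀ (fun s => x s ω)
        (fun s => a s ω) (fun s => I s ω) t) (M' t ω))) P :=
    integrable_finsetSum _ fun t _ => (integrable_weight hw hx ha hI t (h.meas t)).add
      (integrable_weight_of_ne hw hx ha hI t (h.meas t) (hM'm t))
  have h1 := setIntegral_mono_on iJ.integrableOn (iS.add (hF.const_mul _)).integrableOn hBm hpt
  have h2 : ∫ ω in B, N.frameGain Ψ₀ w₀ (fun s => x s ω) (fun s => a s ω)
      (fun s => I s ω) n ∂P = ∫ ω in B, N.frameGain Ψ₀ w₀ (fun s => x s ω) (fun s => a s ω)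
      (fun s => I s ω) (frameLength x₀ x k ω) ∂P :=
    setIntegral_congr_fun hBm fun ω hω => by
      simp only [show frameLength x₀ x k ω = n from hω]
  rw [h2] at hmain
  simp only [Pi.add_apply] at h1
  rw [integral_add iS.restrict (hF.const_mul _).restrict] at h1
  rw [integral_const_mul, integral_add (iI.const_mul _).restrict
    ((hF.const_mul _).const_mul _).restrict, integral_const_mul, integral_const_mul]
  have hR : (0 : ℝ) ≤ N.numMIS := Nat.cast_nonneg _
  have h3 := mul_le_mul_of_nonneg_left h1 hR
  linarith

/-- AMMS gains on the average a fraction of the initial deficit of each link that has arrivals. -/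
lemma IsAMMSRun.arrival_le (hw : ∀ l, 0 ≤ w₀ l) (hx : ∀ t, Measurable[_, ⊤] (x t))
    (ha : IsDeficitArrival N P p x a) (hord : N.IsWeightOrder ord)
    (h : IsAMMSRun N P ord Ψ₀ w₀ x a D I)
    (hF : Integrable (fun ω => (frameLength x₀ x k ω : ℝ) ^ 2) P) (l : K) :
    N.numMIS * (w₀ l * P.real {ω | ∃ t, 1 ≤ t ∧ t ≤ frameLength x₀ x k ω ∧
        ∃ d, 0 < N.arr (x t ω) l d} -
      (N.amax + 1) * ∫ ω, (frameLength x₀ x k ω : ℝ) ^ 2 ∂P) ≤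
      (2 * N.numMIS - 1) * ∫ ω, N.frameGain Ψ₀ w₀ (fun s => x s ω) (fun s => a s ω)
        (fun s => I s ω) (frameLength x₀ x k ω) ∂P := by
  classical
  have hI := h.measurable_decision hx
  have hFm := measurable_frameLength (x₀ := x₀) hx k
  set E : Set Ω := {ω | ∃ t, 1 ≤ t ∧ t ≤ frameLength x₀ x k ω ∧
        ∃ d, 0 < N.arr (x t ω) l d} with hE
  have hEm : MeasurableSet E := by
    have : E = ⋃ t : ℕ, {ω | (frameLength x₀ x k ω, x t ω) ∈
        {q : ℕ × X | 1 ≤ t ∧ t ≤ q.1 ∧ ∃ d, 0 < N.arr q.2 l d}} := by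
      ext ω; simp [hE]
    rw [this]
    exact MeasurableSet.iUnion fun t => measurable_top_prodMk hFm (hx t)
      (t := {q : ℕ × X | 1 ≤ t ∧ t ≤ q.1 ∧ ∃ d, 0 < N.arr q.2 l d}) trivial
  have iE : Integrable (E.indicator fun _ => w₀ l) P := (integrable_const _).indicator hEm
  have iI := integrable_frameGain (Ψ₀ := Ψ₀) (k := k) (x₀ := x₀) hw hx ha hI hF
  have e : w₀ l * P.real E = ∫ ω, E.indicator (fun _ => w₀ l) ω ∂P := by
    rw [integral_indicator hEm, setIntegral_const, smul_eq_mul, mul_comm]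
  rw [e, ← integral_const_mul, ← integral_sub iE (hF.const_mul _), ← integral_const_mul,
    ← integral_const_mul]
  refine integral_le_of_fiber_le hFm ((iE.sub (hF.const_mul _)).const_mul _)
    (iI.const_mul _) fun n => ?_
  set B : Set Ω := {ω | frameLength x₀ x k ω = n} with hB
  have hBT : MeasurableSet[⨆ s, MeasurableSpace.comap (x s) ⊤] B :=
    measurable_top_iff.1 (measurable_frameLength measurable_traffic k) n
  have hBm : MeasurableSet B := measurable_top_iff.1 hFm n
  -- A constant comparison set containing `l` suffices: in a slot with an arrival at `l` its weight
  -- is at least the current deficit of `l`.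
  obtain ⟨M, hM⟩ := N.exists_MIS_superset {l} (Set.pairwise_singleton _ _)
  have hlM : l ∈ M.1 := hM l rfl
  have hmain := h.horizon_le hw hx ha hord n (M' := fun _ _ => M) (fun _ => measurable_const) hBT
  have iS : Integrable (fun ω => ∑ t ∈ Finset.Icc 1 n, (N.weight (N.stateAt Ψ₀ w₀ (fun s => x s ω)
        (fun s => a s ω) (fun s => I s ω) t) (D t ω) +
        if D t ω = M then 0 else N.weight (N.stateAt Ψ₀ w₀ (fun s => x s ω)
        (fun s => a s ω) (fun s => I s ω) t) M)) P :=
    integrable_finsetSum _ fun t _ => (integrable_weight hw hx ha hI t (h.meas t)).add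
      (integrable_weight_of_ne hw hx ha hI t (h.meas t) measurable_const)
  have hpt : ∀ ω ∈ B, E.indicator (fun _ => w₀ l) ω -
      (N.amax + 1) * (frameLength x₀ x k ω : ℝ) ^ 2 ≤
      ∑ t ∈ Finset.Icc 1 n, (N.weight (N.stateAt Ψ₀ w₀ (fun s => x s ω)
        (fun s => a s ω) (fun s => I s ω) t) (D t ω) +
        if D t ω = M then 0 else N.weight (N.stateAt Ψ₀ w₀ (fun s => x s ω)
        (fun s => a s ω) (fun s => I s ω) t) M) := by
    intro ω hω
    have hω : frameLength x₀ x k ω = n := hω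
    set S := fun t => N.stateAt Ψ₀ w₀ (fun s => x s ω) (fun s => a s ω) (fun s => I s ω) t
    have hS0 : ∀ t l, 0 ≤ (S t).deficit l := fun t l => N.stateAt_deficit_nonneg hw t l
    have hterm : ∀ t, N.weight (S t) M ≤ N.weight (S t) (D t ω) +
        if D t ω = M then 0 else N.weight (S t) M := by
      intro t
      split_ifs with hD
      · rw [hD, add_zero]
      · exact le_add_of_nonneg_left (N.weight_nonneg (hS0 t) _)
    have hnn : ∀ t, 0 ≤ N.weight (S t) (D t ω) + if D t ω = M then 0 else N.weight (S t) M :=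
      fun t => (N.weight_nonneg (hS0 t) M).trans (hterm t)
    by_cases hωE : ω ∈ E
    · rw [Set.indicator_of_mem hωE]
      obtain ⟨t, ht1, htn, d, hd⟩ := hωE
      rw [hω] at htn ⊢
      refine le_trans ?_ (Finset.single_le_sum (fun t _ => hnn t) (Finset.mem_Icc.2 ⟨ht1, htn⟩))
      refine le_trans ?_ (hterm t)
      have hbuf : ∃ d, 0 < (S t).buffer l d := by
        obtain ⟨s, rfl⟩ := Nat.exists_eq_succ_of_ne_zero (by omega : t ≠ 0)
        refine ⟨d, ?_⟩
        rw [show (S (s + 1)).buffer = _ from N.stateAt_succ_buffer s]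
        exact Nat.add_pos_right _ hd
      have h1 : (S t).deficit l ≤ N.weight (S t) M :=
        Finset.single_le_sum (f := fun l => (S t).deficit l) (fun l _ => hS0 t l)
          (Finset.mem_filter.2 ⟨hlM, hbuf⟩)
      have h2 := (abs_le.1 (N.abs_stateAt_deficit_sub_le (Ψ₀ := Ψ₀) (x := fun s => x s ω)
        (I := fun s => I s ω) hw (fun t => ha.nonneg t ω) (fun t => ha.le t ω) t l)).1
      have h3 : (t : ℝ) ≤ (n : ℝ) ^ 2 := by
        exact_mod_cast htn.trans (Nat.le_self_pow two_ne_zero n)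
      have h4 : (t : ℝ) * (N.amax + 1) ≤ n ^ 2 * (N.amax + 1) := by gcongr
      linarith
    · rw [Set.indicator_of_notMem hωE]
      have h1 : (0 : ℝ) ≤ (N.amax + 1) * (frameLength x₀ x k ω : ℝ) ^ 2 := by positivity
      have h2 := Finset.sum_nonneg fun t (_ : t ∈ Finset.Icc 1 n) => hnn t
      linarith
  have h1 := setIntegral_mono_on (iE.sub (hF.const_mul _)).integrableOn iS.integrableOn hBm hpt
  have h2 : ∫ ω in B, N.frameGain Ψ₀ w₀ (fun s => x s ω) (fun s => a s ω)
      (fun s => I s ω) n ∂P = ∫ ω in B, N.frameGain Ψ₀ w₀ (fun s => x s ω) (fun s => a s ω)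
      (fun s => I s ω) (frameLength x₀ x k ω) ∂P :=
    setIntegral_congr_fun hBm fun ω hω => by
      simp only [show frameLength x₀ x k ω = n from hω]
  rw [h2] at hmain
  rw [integral_const_mul, integral_const_mul]
  exact (mul_le_mul_of_nonneg_left h1 (Nat.cast_nonneg _)).trans hmain

/-- Dichotomy on the size of `G'`. Either `ε G'` absorbs the error `ρ C`, or `G'` is at most `C / ε
≤ A`, and then the absolute lower bound `ρ A ≤ G` is enough. -/
lemma ratio_guarantee {ρ ε G G' C A : ℝ} (hρ0 : 0 ≤ ρ) (hρ1 : ρ ≤ 1) (hε : 0 < ε) (hG' : 0 ≤ G')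
    (hC : 0 ≤ C) (h1 : ρ * G' ≤ G + ρ * C) (h2 : ρ * A ≤ G) (hA : C / ε ≤ A) :
    (ρ - ε) * G' ≤ G := by
  rw [sub_mul]
  by_cases h : ρ * C ≤ ε * G'
  · linarith
  · have h3 : ε * G' ≤ C := (not_le.1 h).le.trans (mul_le_of_le_one_left hC hρ1)
    have h4 : G' ≤ A := ((le_div_iff₀' hε).2 h3).trans hA
    have h5 := mul_le_mul_of_nonneg_left h4 hρ0
    have h6 : 0 ≤ ε * G' := by positivity
    linarith

end Horizon

end RTSched

/-- Gain guarantee of AMMS over a frame of `k` cycles of the traffic chain, against every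
non-causal policy. -/
theorem mainTheorem6 {K X : Type*} [Fintype K] [Fintype X] [DecidableEq X]
    (N : RTSched.Network K X) (p : K → ℝ) (x₀ : X) (k : ℕ) (ε : ℝ) (hε : 0 < ε) :
    ∃ W' : ℝ, ∀ (Ψ₀ : N.Buffer) (w₀ : K → ℝ), (∀ l, 0 ≤ w₀ l) → W' ≤ ∑ l, w₀ l →
      ∀ (Ω : Type*) [MeasurableSpace Ω] (P : Measure Ω) [IsProbabilityMeasure P]
        (x : ℕ → Ω → X) (a : ℕ → Ω → K → ℝ),
        RTSched.IsTraffic N P x₀ x → RTSched.IsDeficitArrival N P p x a →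
      ∀ (ord : N.State → Fin N.numMIS ≃ N.MIS), N.IsWeightOrder ord →
      ∀ (D : ℕ → Ω → N.MIS) (I : ℕ → Ω → N.Schedule),
        RTSched.IsAMMSRun N P ord Ψ₀ w₀ x a D I →
      ∀ (J : ℕ → Ω → N.Schedule), RTSched.IsNonCausalRun N Ψ₀ w₀ x a J →
        Integrable (fun ω => N.frameGain Ψ₀ w₀ (fun s => x s ω) (fun s => a s ω)
          (fun s => I s ω) (RTSched.frameLength x₀ x k ω)) P ∧
        Integrable (fun ω => N.frameGain Ψ₀ w₀ (fun s => x s ω) (fun s => a s ω)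
          (fun s => J s ω) (RTSched.frameLength x₀ x k ω)) P ∧
        ((N.numMIS : ℝ) / (2 * N.numMIS - 1) - ε) *
            ∫ ω, N.frameGain Ψ₀ w₀ (fun s => x s ω) (fun s => a s ω)
              (fun s => J s ω) (RTSched.frameLength x₀ x k ω) ∂P ≤
          ∫ ω, N.frameGain Ψ₀ w₀ (fun s => x s ω) (fun s => a s ω)
            (fun s => I s ω) (RTSched.frameLength x₀ x k ω) ∂P := by
  obtain ⟨T, hT0, hT⟩ := RTSched.exists_integral_frameLength_sq_le N x₀ k
  have hb : (0 : ℝ) ≤ N.amax + 1 := by positivity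
  have hR : (1 : ℝ) ≤ N.numMIS := by exact_mod_cast N.one_le_numMIS
  obtain ⟨R, hRdef⟩ : ∃ R : ℝ, (N.numMIS : ℝ) = R := ⟨_, rfl⟩
  rw [hRdef] at hR
  -- In these cases all gains vanish almost surely, and there is no link from which a lower bound
  -- could be drawn.
  by_cases hdeg : k = 0 ∨ IsEmpty K
  · refine ⟨0, fun Ψ₀ w₀ hw _ Ω _ P _ x a hx ha ord hord D I hI J hJ => ?_⟩
    have hF := (hT Ω P x hx).1
    refine ⟨RTSched.integrable_frameGain hw hx.meas ha (hI.measurable_decision hx.meas) hF,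
      RTSched.integrable_frameGain hw hx.meas ha (fun s _ => hJ.meas s) hF, ?_⟩
    have h0 : ∀ I : ℕ → Ω → N.Schedule, ∫ ω, N.frameGain Ψ₀ w₀ (fun s => x s ω)
        (fun s => a s ω) (fun s => I s ω) (RTSched.frameLength x₀ x k ω) ∂P = 0 := by
      intro I
      refine integral_eq_zero_of_ae ?_
      filter_upwards [hx.ae_start] with ω hω
      rcases hdeg with rfl | hK
      · have : RTSched.frameLength x₀ x 0 ω = 0 := Nat.nth_zero_of_zero hω
        simp [this, RTSched.Network.frameGain]
      · simp [RTSched.Network.frameGain, RTSched.Network.gain]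
    rw [h0, h0, mul_zero]
  rw [not_or, not_isEmpty_iff] at hdeg
  obtain ⟨hk, hK⟩ := hdeg
  choose q' hq'0 hq' using fun l =>
    RTSched.exists_le_real_arrival N x₀ (Nat.one_le_iff_ne_zero.2 hk) l
  obtain ⟨l₁, -, hl₁⟩ := Finset.exists_min_image Finset.univ q' Finset.univ_nonempty
  set q := q' l₁
  have hq0 : 0 < q := hq'0 l₁
  have hκ : (0 : ℝ) < Fintype.card K := by exact_mod_cast Fintype.card_pos
  set C : ℝ := 2 * (Fintype.card K * (N.amax + 1)) * T with hC
  have hC0 : 0 ≤ C := by positivity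
  -- By pigeonhole some link `l` carries at least the fraction `1 / |K|` of the threshold, which is
  -- precisely what makes `w₀ l * q - (amax + 1) * T ≥ C / ε`.
  refine ⟨Fintype.card K * ((C / ε + (N.amax + 1) * T) / q),
    fun Ψ₀ w₀ hw hW Ω _ P _ x a hx ha ord hord D I hI J hJ => ?_⟩
  obtain ⟨hF, hFT⟩ := hT Ω P x hx
  refine ⟨RTSched.integrable_frameGain hw hx.meas ha (hI.measurable_decision hx.meas) hF,
    RTSched.integrable_frameGain hw hx.meas ha (fun s _ => hJ.meas s) hF, ?_⟩
  obtain ⟨l, -, hl⟩ := Finset.exists_le_of_sum_le (s := Finset.univ) (g := w₀)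
    (f := fun _ : K => (C / ε + (N.amax + 1) * T) / q) Finset.univ_nonempty (by simpa using hW)
  have h1 := hI.frame_le hw hx.meas ha hord hJ hF
  have h2 := hI.arrival_le hw hx.meas ha hord hF l
  have hp := (hl₁ l (Finset.mem_univ l)).trans (hq' l Ω P x hx)
  rw [hRdef] at h1 h2 ⊢
  have h2R : (0 : ℝ) < 2 * R - 1 := by linarith
  refine RTSched.ratio_guarantee (C := C) (A := w₀ l * q - (N.amax + 1) * T)
    (div_nonneg (by linarith) h2R.le) ((div_le_one h2R).2 (by linarith)) hε
    (integral_nonneg fun ω => N.frameGain_nonneg hw _) hC0 ?_ ?_ ?_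
  · rw [div_mul_eq_mul_div, div_mul_eq_mul_div, div_le_iff₀ h2R, add_mul, div_mul_cancel₀ _ h2R.ne']
    have h3 : 2 * (Fintype.card K * ((N.amax : ℝ) + 1)) *
        ∫ ω, (RTSched.frameLength x₀ x k ω : ℝ) ^ 2 ∂P ≤ C :=
      mul_le_mul_of_nonneg_left hFT (by positivity)
    have h4 := mul_le_mul_of_nonneg_left h3 (by linarith : 0 ≤ R)
    linarith
  · rw [div_mul_eq_mul_div, div_le_iff₀ h2R]
    have h3 := mul_le_mul_of_nonneg_left hp (hw l)
    have h4 := mul_le_mul_of_nonneg_left hFT hb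
    have h5 := mul_le_mul_of_nonneg_left (sub_le_sub h3 h4) (by linarith : 0 ≤ R)
    linarith
  · rw [div_le_iff₀ hq0] at hl
    linarith
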